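/- All graphs are finite. A perfect matching of a graph $G$ is a set of edges such that every vertex of $G$ is incident with exactly one of them. An edge of $G$ is called lonely if it belongs to exactly one perfect matching of $G$, and $G$ is matching double covered if every edge of $G$ belongs to at least two distinct perfect matchings. Let $\mathcal{U}$ be the class of all $3$-connected cubic graphs that are not matching double covered, and let $\mathcal{U}_n$ be the class of all graphs in $\mathcal{U}$ with exactly $n$ lonely edges. Theorem. For every integer $k\ge 2$ there is a graph in $\mathcal{U}_2$ with exactly $k$ triangles, and there is a graph in $\mathcal{U}_1$ with exactly $k$ triangles. -/

import Mathlib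

namespace LonelyEdges

/-- `G` is `k`-connected: it has more than `k` vertices, and deleting fewer than `k` vertices
always leaves a connected graph. -/
def IsVertexConnected {V : Type*} [Fintype V] (G : SimpleGraph V) (k : ℕ) : Prop :=
  k < Fintype.card V ∧
    ∀ S : Finset V, S.card < k → (G.induce {v : V | v ∉ S}).Connected

/-- Every edge of `G` belongs to at least two distinct perfect matchings. -/
def IsMatchingDoubleCovered {V : Type*} (G : SimpleGraph V) : Prop :=
  ∀ e ∈ G.edgeSet, ∃ M₁ M₂ : G.Subgraph, M₁ ≠ M₂ ∧
    M₁.IsPerfectMatching ∧ M₂.IsPerfectMatching ∧ e ∈ M₁.edgeSet ∧ e ∈ M₂.edgeSet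

/-- The lonely edges of `G`: the edges that belong to exactly one perfect matching. -/
def lonelyEdges {V : Type*} (G : SimpleGraph V) : Set (Sym2 V) :=
  {e | e ∈ G.edgeSet ∧ ∃! M : G.Subgraph, M.IsPerfectMatching ∧ e ∈ M.edgeSet}

/-- The class `𝒰` of `3`-connected cubic graphs that are not matching double covered.
(A `3`-connected cubic graph has no parallel edges, so simple graphs suffice.) -/
structure InU {V : Type*} [Fintype V] (G : SimpleGraph V) [DecidableRel G.Adj] : Prop where
  cubic : G.IsRegularOfDegree 3
  threeConnected : IsVertexConnected G 3
  notDoubleCovered : ¬ IsMatchingDoubleCovered G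

/-- The class `𝒰_n` of the graphs in `𝒰` with exactly `n` lonely edges. -/
def InUWith {V : Type*} [Fintype V] (G : SimpleGraph V) [DecidableRel G.Adj] (n : ℕ) : Prop :=
  InU G ∧ (lonelyEdges G).ncard = n

end LonelyEdges

namespace LonelyEdges

/-! The number of triangles is raised one at a time by a local operation that preserves the number
of lonely edges. In a triangle `xab`, blow up `a` and `b` into triangles `{a, 0, 1}` and `{b, 2,
3}`, so that `xab` becomes the 5-cycle `x, 1, 0, 2, 3`. The graph stays cubic and 3-connected. If no
edge of `xab` lies in another triangle, one triangle is lost and two are gained.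

By `IsPM.exists_lift`, every perfect matching of the new graph is a lift of an old one. A matching
that contains `ab`, or no edge of the triangle, has one lift; a matching that contains `xa` or `xb`
has two. Among the six kinds of lift only `liftB`, which comes from matchings through `xa`, contains
the edge `0a`. So if `xa` is lonely, `0a` is lonely. Any other lonely edge stays lonely if its
matching contains `ab`, and the lift of that matching contains `a1`. Thus the triangle `(0, a, 1)`
can take over the role of `(x, a, b)`. `IsSeed` is the resulting invariant and `IsSeed.expand` the
induction step; the remaining edges keep, or receive, two matchings.

The induction starts from two explicit seeds with three triangles. Two further explicit graphs
settle `k = 2`. All four are verified by evaluating a search for matchings and a depth-first search.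
-/

/-- A perfect matching, encoded as the involution exchanging matched vertices. -/
def IsPM {V : Type*} (G : SimpleGraph V) (f : V → V) : Prop :=
  ∀ v, G.Adj v (f v) ∧ f (f v) = v

/-- The edge `pq` lies in two distinct perfect matchings. -/
def InTwo {V : Type*} (G : SimpleGraph V) (p q : V) : Prop :=
  ∃ f g, f ≠ g ∧ IsPM G f ∧ IsPM G g ∧ f p = q ∧ g p = q

/-- The edge `pq` lies in exactly one perfect matching. -/
def InOne {V : Type*} (G : SimpleGraph V) (p q : V) : Prop :=
  ∃ f, IsPM G f ∧ f p = q ∧ ∀ g, IsPM G g → g p = q → g = f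

/-! ### Perfect matchings as involutions, and lonely edges -/

section Matchings

variable {V : Type*} {G : SimpleGraph V}

lemma IsPM.adj {f : V → V} (hf : IsPM G f) (v : V) : G.Adj v (f v) := (hf v).1

lemma IsPM.invol {f : V → V} (hf : IsPM G f) (v : V) : f (f v) = v := (hf v).2

/-- The subgraph of the matched edges. -/
def IsPM.toSubgraph {f : V → V} (hf : IsPM G f) : G.Subgraph where
  verts := Set.univ
  Adj v w := f v = w
  adj_sub := by rintro v w rfl; exact hf.adj v
  edge_vert := fun _ => Set.mem_univ _
  symm := ⟨fun v w (h : f v = w) => show f w = v from h ▸ hf.invol v⟩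

lemma IsPM.isPerfectMatching {f : V → V} (hf : IsPM G f) : hf.toSubgraph.IsPerfectMatching :=
  ⟨fun v _ => ⟨f v, rfl, fun w h => (show f v = w from h).symm⟩, fun v => Set.mem_univ v⟩

lemma exists_toSubgraph_eq {M : G.Subgraph} (hM : M.IsPerfectMatching) :
    ∃ (f : V → V) (hf : IsPM G f), hf.toSubgraph = M := by
  choose f hf hf' using fun v => hM.1 (hM.2 v)
  have h : IsPM G f := fun v => ⟨M.adj_sub (hf v), (hf' (f v) v (hf v).symm).symm⟩
  refine ⟨f, h, SimpleGraph.Subgraph.ext ?_ ?_⟩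
  · exact (Set.eq_univ_of_forall hM.2).symm
  · ext v w
    exact ⟨fun e => by have : f v = w := e
                       exact this ▸ hf v, fun e => (hf' v w e).symm⟩

lemma IsPM.toSubgraph_inj {f g : V → V} (hf : IsPM G f) (hg : IsPM G g)
    (h : hf.toSubgraph = hg.toSubgraph) : f = g := by
  funext v
  have : hf.toSubgraph.Adj v (f v) := rfl
  rw [h] at this
  exact (show g v = f v from this).symm

lemma existsUnique_subgraph_iff {p q : V} :
    (∃! M : G.Subgraph, M.IsPerfectMatching ∧ s(p, q) ∈ M.edgeSet) ↔ InOne G p q := by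
  constructor
  · rintro ⟨M, ⟨hM, he⟩, hu⟩
    obtain ⟨f, hf, rfl⟩ := exists_toSubgraph_eq hM
    exact ⟨f, hf, he, fun g hg e =>
      hg.toSubgraph_inj hf (hu _ ⟨hg.isPerfectMatching, e⟩)⟩
  · rintro ⟨f, hf, he, hu⟩
    refine ⟨hf.toSubgraph, ⟨hf.isPerfectMatching, he⟩, ?_⟩
    rintro M ⟨hM, e⟩
    obtain ⟨g, hg, rfl⟩ := exists_toSubgraph_eq hM
    have := hu g hg e
    subst this
    rfl

lemma InOne.adj {p q : V} (h : InOne G p q) : G.Adj p q := by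
  obtain ⟨f, hf, rfl, -⟩ := h
  exact hf.adj p

lemma mk_mem_lonelyEdges {p q : V} : s(p, q) ∈ lonelyEdges G ↔ InOne G p q :=
  ⟨fun h => existsUnique_subgraph_iff.1 h.2, fun h => ⟨h.adj, existsUnique_subgraph_iff.2 h⟩⟩

lemma InTwo.not_inOne {p q : V} (h : InTwo G p q) : ¬ InOne G p q := by
  rintro ⟨m, -, -, hu⟩
  obtain ⟨f, g, hne, hf, hg, e, e'⟩ := h
  exact hne ((hu f hf e).trans (hu g hg e').symm)

lemma InTwo.symm {p q : V} (h : InTwo G p q) : InTwo G q p := by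
  obtain ⟨f, g, hne, hf, hg, rfl, e⟩ := h
  exact ⟨f, g, hne, hf, hg, hf.invol p, by rw [← e, hg.invol]⟩

lemma InOne.symm {p q : V} (h : InOne G p q) : InOne G q p := by
  obtain ⟨f, hf, rfl, hu⟩ := h
  refine ⟨f, hf, hf.invol p, fun g hg e => hu g hg ?_⟩
  have := hg.invol (f p)
  rwa [e] at this

lemma not_isMatchingDoubleCovered {p q : V} (h : InOne G p q) : ¬ IsMatchingDoubleCovered G := by
  intro hd
  obtain ⟨M₁, M₂, hne, h₁, h₂, e₁, e₂⟩ := hd s(p, q) h.adj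
  exact hne ((existsUnique_subgraph_iff.2 h).unique ⟨h₁, e₁⟩ ⟨h₂, e₂⟩)

lemma lonelyEdges_eq {E : Set (Sym2 V)} (h₁ : ∀ p q, s(p, q) ∈ E → InOne G p q)
    (h₂ : ∀ p q, G.Adj p q → s(p, q) ∉ E → InTwo G p q) : lonelyEdges G = E := by
  ext e
  induction e with
  | _ p q =>
    rw [mk_mem_lonelyEdges]
    refine ⟨fun h => ?_, h₁ p q⟩
    by_contra hE
    exact (h₂ p q h.adj hE).not_inOne h

end Matchings

/-! ### Cubic graphs and 3-connectedness through walks -/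

/-- Every vertex has exactly three neighbours. -/
def Cubic {V : Type*} (G : SimpleGraph V) : Prop :=
  ∀ v, ∃ p q r, p ≠ q ∧ p ≠ r ∧ q ≠ r ∧ ∀ w, G.Adj v w ↔ w = p ∨ w = q ∨ w = r

/-- Adjacency in the graph with the vertices `s` and `t` deleted. -/
def AdjAvoiding {V : Type*} (G : SimpleGraph V) (s t p q : V) : Prop :=
  G.Adj p q ∧ p ≠ s ∧ p ≠ t ∧ q ≠ s ∧ q ≠ t

/-- Deleting at most two vertices leaves all remaining vertices joined by walks. -/
def Conn3 {V : Type*} (G : SimpleGraph V) : Prop :=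
  ∀ s t u v, u ≠ s → u ≠ t → v ≠ s → v ≠ t → Relation.ReflTransGen (AdjAvoiding G s t) u v

section Basic

variable {V : Type*} {G : SimpleGraph V}

lemma Cubic.isRegularOfDegree [Fintype V] [DecidableRel G.Adj] (h : Cubic G) :
    G.IsRegularOfDegree 3 := by
  classical
  intro v
  obtain ⟨p, q, r, hpq, hpr, hqr, hv⟩ := h v
  rw [← SimpleGraph.card_neighborFinset_eq_degree, Finset.card_eq_three]
  refine ⟨p, q, r, hpq, hpr, hqr, ?_⟩
  ext w
  simp [hv]

lemma Cubic.exists_third (h : Cubic G) {v p q : V} (hp : G.Adj v p) (hq : G.Adj v q)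
    (hpq : p ≠ q) : ∃ r, r ≠ p ∧ r ≠ q ∧ ∀ w, G.Adj v w ↔ w = p ∨ w = q ∨ w = r := by
  obtain ⟨p', q', r', h₁, h₂, h₃, hv⟩ := h v
  rcases (hv p).1 hp with rfl | rfl | rfl <;> rcases (hv q).1 hq with rfl | rfl | rfl <;>
    first
    | exact absurd rfl hpq
    | exact ⟨r', by grind, by grind, by grind⟩
    | exact ⟨q', by grind, by grind, by grind⟩
    | exact ⟨p', by grind, by grind, by grind⟩

lemma AdjAvoiding.symm {s t p q : V} (h : AdjAvoiding G s t p q) : AdjAvoiding G s t q p :=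
  ⟨h.1.symm, h.2.2.2.1, h.2.2.2.2, h.2.1, h.2.2.1⟩

lemma Conn3.isVertexConnected [Fintype V] (h : Conn3 G) (hc : 5 ≤ Fintype.card V) :
    IsVertexConnected G 3 := by
  classical
  refine ⟨by omega, fun S hS => ?_⟩
  have hne : ∃ v, v ∉ S := by
    by_contra! hall
    have : S = Finset.univ := Finset.eq_univ_of_forall hall
    rw [this, Finset.card_univ] at hS
    omega
  obtain ⟨v₀, hv₀⟩ := hne
  have : Nonempty {v : V | v ∉ S} := ⟨⟨v₀, hv₀⟩⟩
  refine SimpleGraph.Connected.mk ?_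
  rintro ⟨u, hu⟩ ⟨v, hv⟩
  -- `Conn3` deletes a pair of vertices, so `S` is enlarged to a pair that misses `u` and `v`; a
  -- walk avoiding the larger set avoids `S`.
  obtain ⟨T, hST, hT, hT2⟩ : ∃ T, S ⊆ T ∧ T ⊆ Finset.univ \ {u, v} ∧ T.card = 2 := by
    refine Finset.exists_subsuperset_card_eq ?_ (by omega) ?_
    · intro w hw
      simp only [Finset.mem_sdiff, Finset.mem_univ, Finset.mem_insert, Finset.mem_singleton,
        true_and, not_or]
      exact ⟨fun e => hu (e ▸ hw), fun e => hv (e ▸ hw)⟩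
    · have h₁ := Finset.le_card_sdiff ({u, v} : Finset V) Finset.univ
      have h₂ : ({u, v} : Finset V).card ≤ 2 := Finset.card_le_two
      rw [Finset.card_univ] at h₁
      omega
  obtain ⟨s, t, -, rfl⟩ := Finset.card_eq_two.1 hT2
  have hs : s ∈ Finset.univ \ {u, v} := hT (by simp)
  have ht : t ∈ Finset.univ \ {u, v} := hT (by simp)
  simp only [Finset.mem_sdiff, Finset.mem_univ, Finset.mem_insert, Finset.mem_singleton,
    true_and, not_or] at hs ht
  have hout : ∀ w, w ≠ s → w ≠ t → w ∉ S := fun w h₁ h₂ hw => by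
    have := hST hw
    simp only [Finset.mem_insert, Finset.mem_singleton] at this
    tauto
  have hw := h s t u v (Ne.symm hs.1) (Ne.symm ht.1) (Ne.symm hs.2) (Ne.symm ht.2)
  suffices H : ∀ w, Relation.ReflTransGen (AdjAvoiding G s t) u w → ∀ hw : w ∉ S,
      (G.induce {v : V | v ∉ S}).Reachable ⟨u, hu⟩ ⟨w, hw⟩ from H v hw hv
  intro w hw
  induction hw with
  | refl => exact fun _ => SimpleGraph.Reachable.refl _
  | tail _ hbc ih =>
    intro hc
    have hb := hout _ hbc.2.1 hbc.2.2.1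
    refine (ih hb).trans (SimpleGraph.Adj.reachable ?_)
    exact hbc.1

lemma inUWith_of {V : Type*} [Fintype V] {G : SimpleGraph V} [DecidableRel G.Adj]
    (hc : 5 ≤ Fintype.card V) (h₁ : Cubic G) (h₂ : Conn3 G)
    {E : Set (Sym2 V)} (hE : E.Nonempty) (h₃ : ∀ p q, s(p, q) ∈ E → InOne G p q)
    (h₄ : ∀ p q, G.Adj p q → s(p, q) ∉ E → InTwo G p q) :
    InUWith G E.ncard := by
  refine ⟨⟨h₁.isRegularOfDegree, h₂.isVertexConnected hc, ?_⟩, by rw [lonelyEdges_eq h₃ h₄]⟩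
  obtain ⟨e, he⟩ := hE
  induction e with
  | _ p q => exact not_isMatchingDoubleCovered (h₃ p q he)

end Basic

open Sum

/-! ### Expanding a triangle, and the perfect matchings of the expansion -/

section Expand

variable {V : Type*}

/-- Adjacency between the old vertices `x, a, b` and the new ones. -/
def linkAdj (x a b p : V) (i : Fin 4) : Prop :=
  p = x ∧ (i = 1 ∨ i = 3) ∨ p = a ∧ (i = 0 ∨ i = 1) ∨ p = b ∧ (i = 2 ∨ i = 3)

/-- Adjacency between the new vertices. -/
def newAdj (i j : Fin 4) : Prop :=
  i = 0 ∧ j = 1 ∨ i = 1 ∧ j = 0 ∨ i = 2 ∧ j = 3 ∨ i = 3 ∧ j = 2 ∨ i = 0 ∧ j = 2 ∨ i = 2 ∧ j = 0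

/-- Replace the vertices `a` and `b` of the triangle `xab` by triangles `{a, 0, 1}` and
`{b, 2, 3}`; the edges `ab`, `ax`, `bx` become `02`, `1x`, `3x`. -/
def expand (G : SimpleGraph V) (x a b : V) : SimpleGraph (V ⊕ Fin 4) where
  Adj u v := match u, v with
    | inl p, inl q => G.Adj p q ∧ ¬ ((p = x ∨ p = a ∨ p = b) ∧ (q = x ∨ q = a ∨ q = b))
    | inl p, inr i => linkAdj x a b p i
    | inr i, inl p => linkAdj x a b p i
    | inr i, inr j => newAdj i j
  symm := ⟨by
    rintro (p | i) (q | j) h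
    · exact ⟨h.1.symm, fun h' => h.2 h'.symm⟩
    · exact h
    · exact h
    · revert h; unfold newAdj; grind⟩
  loopless := ⟨by
    rintro (p | i) h
    · exact G.loopless.irrefl p h.1
    · revert h; unfold newAdj; grind⟩

variable {G : SimpleGraph V} {x a b : V}

@[simp] lemma expand_inl_inl {p q : V} : (expand G x a b).Adj (inl p) (inl q) ↔
    G.Adj p q ∧ ¬ ((p = x ∨ p = a ∨ p = b) ∧ (q = x ∨ q = a ∨ q = b)) := Iff.rfl

@[simp] lemma expand_inl_inr {p : V} {i : Fin 4} : (expand G x a b).Adj (inl p) (inr i) ↔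
    p = x ∧ (i = 1 ∨ i = 3) ∨ p = a ∧ (i = 0 ∨ i = 1) ∨ p = b ∧ (i = 2 ∨ i = 3) := Iff.rfl

@[simp] lemma expand_inr_inl {p : V} {i : Fin 4} : (expand G x a b).Adj (inr i) (inl p) ↔
    p = x ∧ (i = 1 ∨ i = 3) ∨ p = a ∧ (i = 0 ∨ i = 1) ∨ p = b ∧ (i = 2 ∨ i = 3) := Iff.rfl

@[simp] lemma expand_inr_inr {i j : Fin 4} : (expand G x a b).Adj (inr i) (inr j) ↔
    i = 0 ∧ j = 1 ∨ i = 1 ∧ j = 0 ∨ i = 2 ∧ j = 3 ∨ i = 3 ∧ j = 2 ∨ i = 0 ∧ j = 2 ∨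
      i = 2 ∧ j = 0 := Iff.rfl

open Classical in
/-- The map on the expanded graph which sends the old vertices `x, a, b` to prescribed new
vertices, or to their images under `f`, and the new vertices to prescribed vertices. -/
noncomputable def lift (x a b : V) (f : V → V) (cx ca cb : Option (Fin 4))
    (r : Fin 4 → V ⊕ Fin 4) : V ⊕ Fin 4 → V ⊕ Fin 4
  | inl v => ((if v = x then cx else if v = a then ca else if v = b then cb else none).map
      inr).getD (inl (f v))
  | inr i => r i

/-- The lift of a perfect matching containing `ab`. -/
noncomputable def liftX (x a b : V) (f : V → V) : V ⊕ Fin 4 → V ⊕ Fin 4 :=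
  lift x a b f none (some 1) (some 3) ![inr 2, inl a, inr 0, inl b]

/-- The lift of a perfect matching containing `xb` which contains `01`. -/
noncomputable def liftA (x a b : V) (f : V → V) : V ⊕ Fin 4 → V ⊕ Fin 4 :=
  lift x a b f (some 3) none (some 2) ![inr 1, inr 0, inl b, inl x]

/-- The lift of a perfect matching containing `xb` which contains `02`. -/
noncomputable def liftA' (x a b : V) (f : V → V) : V ⊕ Fin 4 → V ⊕ Fin 4 :=
  lift x a b f (some 1) none (some 3) ![inr 2, inl x, inr 0, inl b]

/-- The lift of a perfect matching containing `xa` which contains `23`. -/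
noncomputable def liftB (x a b : V) (f : V → V) : V ⊕ Fin 4 → V ⊕ Fin 4 :=
  lift x a b f (some 1) (some 0) none ![inl a, inl x, inr 3, inr 2]

/-- The lift of a perfect matching containing `xa` which contains `02`. -/
noncomputable def liftB' (x a b : V) (f : V → V) : V ⊕ Fin 4 → V ⊕ Fin 4 :=
  lift x a b f (some 3) (some 1) none ![inr 2, inl a, inr 0, inl x]

/-- The lift of a perfect matching containing no edge of the triangle `xab`. -/
noncomputable def liftL (x a b : V) (f : V → V) : V ⊕ Fin 4 → V ⊕ Fin 4 :=
  lift x a b f none none none ![inr 1, inr 0, inr 3, inr 2]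

section Lifts

variable {f : V → V} (hf : IsPM G f) (hxa : x ≠ a) (hxb : x ≠ b) (hab : a ≠ b)
include hf hxa hxb hab

lemma isPM_liftX (h : f a = b) : IsPM (expand G x a b) (liftX x a b f) := by
  have h' : f b = a := h ▸ hf.invol a
  have h1 := hf.adj
  have h2 := hf.invol
  have h3 := fun v => (h1 v).ne'
  rintro (v | i)
  · by_cases hx : v = x <;> by_cases ha : v = a <;> by_cases hb : v = b <;>
      simp_all [liftX, lift] <;> grind
  · fin_cases i <;> simp_all [liftX, lift] <;> grind

lemma isPM_liftA (h : f x = b) : IsPM (expand G x a b) (liftA x a b f) := by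
  have h' : f b = x := h ▸ hf.invol x
  have h1 := hf.adj
  have h2 := hf.invol
  have h3 := fun v => (h1 v).ne'
  rintro (v | i)
  · by_cases hx : v = x <;> by_cases ha : v = a <;> by_cases hb : v = b <;>
      simp_all [liftA, lift] <;> grind
  · fin_cases i <;> simp_all [liftA, lift]; grind

lemma isPM_liftA' (h : f x = b) : IsPM (expand G x a b) (liftA' x a b f) := by
  have h' : f b = x := h ▸ hf.invol x
  have h1 := hf.adj
  have h2 := hf.invol
  have h3 := fun v => (h1 v).ne'
  rintro (v | i)
  · by_cases hx : v = x <;> by_cases ha : v = a <;> by_cases hb : v = b <;>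
      simp_all [liftA', lift] <;> grind
  · fin_cases i <;> simp_all [liftA', lift]; grind

lemma isPM_liftB (h : f x = a) : IsPM (expand G x a b) (liftB x a b f) := by
  have h' : f a = x := h ▸ hf.invol x
  have h1 := hf.adj
  have h2 := hf.invol
  have h3 := fun v => (h1 v).ne'
  rintro (v | i)
  · by_cases hx : v = x <;> by_cases ha : v = a <;> by_cases hb : v = b <;>
      simp_all [liftB, lift] <;> grind
  · fin_cases i <;> simp_all [liftB, lift]; grind

lemma isPM_liftB' (h : f x = a) : IsPM (expand G x a b) (liftB' x a b f) := by
  have h' : f a = x := h ▸ hf.invol x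
  have h1 := hf.adj
  have h2 := hf.invol
  have h3 := fun v => (h1 v).ne'
  rintro (v | i)
  · by_cases hx : v = x <;> by_cases ha : v = a <;> by_cases hb : v = b <;>
      simp_all [liftB', lift] <;> grind
  · fin_cases i <;> simp_all [liftB', lift]; grind

lemma isPM_liftL (h : f x ≠ a) (h' : f x ≠ b) (h'' : f a ≠ b) :
    IsPM (expand G x a b) (liftL x a b f) := by
  have h1 := hf.adj
  have h2 := hf.invol
  have h3 := fun v => (h1 v).ne'
  rintro (v | i)
  · by_cases hx : v = x <;> by_cases ha : v = a <;> by_cases hb : v = b <;>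
      simp_all [liftL, lift] <;> grind
  · fin_cases i <;> simp_all [liftL, lift]

end Lifts

/-- If `02` is matched, then `1` goes to `a` or `x` and `3` to `b` or `x`, not both to `x`.
Otherwise `0` goes to `a` or `1` and `2` to `b` or `3`, and `0a`, `2b` together would force both `1`
and `3` onto `x`. The six cases are, in order, those of `liftX`, `liftA`, `liftA'`, `liftB`,
`liftB'`, `liftL`. -/
lemma IsPM.expand_cases {g : V ⊕ Fin 4 → V ⊕ Fin 4} (hg : IsPM (expand G x a b) g)
    (hxa : x ≠ a) (hxb : x ≠ b) :
    (g (inr 0) = inr 2 ∧ g (inr 1) = inl a ∧ g (inr 3) = inl b) ∨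
    (g (inr 0) = inr 1 ∧ g (inr 2) = inl b ∧ g (inr 3) = inl x) ∨
    (g (inr 0) = inr 2 ∧ g (inr 1) = inl x ∧ g (inr 3) = inl b) ∨
    (g (inr 0) = inl a ∧ g (inr 1) = inl x ∧ g (inr 2) = inr 3) ∨
    (g (inr 0) = inr 2 ∧ g (inr 1) = inl a ∧ g (inr 3) = inl x) ∨
    (g (inr 0) = inr 1 ∧ g (inr 2) = inr 3) := by
  have key : ∀ i, ∃ u, g (inr i) = u ∧ (expand G x a b).Adj (inr i) u ∧ g u = inr i :=
    fun i => ⟨_, rfl, hg.adj _, hg.invol _⟩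
  obtain ⟨u0, e0, h0, i0⟩ := key 0
  obtain ⟨u1, e1, h1, i1⟩ := key 1
  obtain ⟨u2, e2, h2, i2⟩ := key 2
  obtain ⟨u3, e3, h3, i3⟩ := key 3
  have c0 : u0 = inl a ∨ u0 = inr 1 ∨ u0 = inr 2 := by
    rcases u0 with p | i <;> simp at h0 ⊢ <;> tauto
  have c1 : u1 = inl a ∨ u1 = inl x ∨ u1 = inr 0 := by
    rcases u1 with p | i <;> simp at h1 ⊢ <;> tauto
  have c2 : u2 = inl b ∨ u2 = inr 3 ∨ u2 = inr 0 := by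
    rcases u2 with p | i <;> simp at h2 ⊢ <;> tauto
  have c3 : u3 = inl b ∨ u3 = inl x ∨ u3 = inr 2 := by
    rcases u3 with p | i <;> simp at h3 ⊢ <;> tauto
  clear h0 h1 h2 h3 key hg
  rcases c0 with rfl | rfl | rfl <;> rcases c1 with rfl | rfl | rfl <;>
    rcases c2 with rfl | rfl | rfl <;> rcases c3 with rfl | rfl | rfl <;> simp_all

open Classical in
/-- The map on the old graph induced by a map on the expanded graph, with `p` and `q`
exchanged. -/
noncomputable def project (g : V ⊕ Fin 4 → V ⊕ Fin 4) (p q v : V) : V :=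
  if v = p then q else if v = q then p else (g (inl v)).elim id fun _ => v

/-- When exactly two old vertices are matched to new ones, matching these two with each other along
a triangle edge repairs the restriction to the old graph. -/
lemma isPM_project {g : V ⊕ Fin 4 → V ⊕ Fin 4} (hg : IsPM (expand G x a b) g) {p q : V}
    (hpq : G.Adj p q) (hp : ∃ i, g (inl p) = inr i) (hq : ∃ i, g (inl q) = inr i)
    (h : ∀ v, v ≠ p → v ≠ q → ∃ w, g (inl v) = inl w) : IsPM G (project g p q) := by
  intro v
  by_cases h1 : v = p
  · subst h1
    simp [project, hpq, hpq.ne']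
  by_cases h2 : v = q
  · subst h2
    simp [project, hpq.ne', hpq.symm]
  obtain ⟨w, hw⟩ := h v h1 h2
  have h3 := hg.adj (inl v)
  have h4 := hg.invol (inl v)
  rw [hw] at h3 h4
  have h5 : w ≠ p := by rintro rfl; obtain ⟨i, hi⟩ := hp; simp [h4] at hi
  have h6 : w ≠ q := by rintro rfl; obtain ⟨i, hi⟩ := hq; simp [h4] at hi
  simp only [project, h1, h2, if_false, hw, elim_inl, id, h5, h6, h4]
  exact ⟨h3.1, trivial⟩

lemma isPM_project_self {g : V ⊕ Fin 4 → V ⊕ Fin 4} (hg : IsPM (expand G x a b) g)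
    (h : ∀ v, ∃ w, g (inl v) = inl w) : IsPM G (fun v => (g (inl v)).elim id fun _ => v) := by
  intro v
  obtain ⟨w, hw⟩ := h v
  have h3 := hg.adj (inl v)
  have h4 := hg.invol (inl v)
  rw [hw] at h3 h4
  simp only [hw, elim_inl, id, h4]
  exact ⟨h3.1, trivial⟩

lemma IsPM.eq_inl_or {g : V ⊕ Fin 4 → V ⊕ Fin 4} (hg : IsPM (expand G x a b) g) (v : V) :
    (∃ w, g (inl v) = inl w) ∨
    (v = x ∧ (g (inr 1) = inl v ∨ g (inr 3) = inl v)) ∨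
    (v = a ∧ (g (inr 0) = inl v ∨ g (inr 1) = inl v)) ∨
    (v = b ∧ (g (inr 2) = inl v ∨ g (inr 3) = inl v)) := by
  have h1 := hg.adj (inl v)
  have h2 := hg.invol (inl v)
  rcases h : g (inl v) with w | i
  · exact Or.inl ⟨w, rfl⟩
  · rw [h] at h1 h2
    rcases h1 with ⟨rfl, rfl | rfl⟩ | ⟨rfl, rfl | rfl⟩ | ⟨rfl, rfl | rfl⟩ <;> simp [h2]

lemma eq_lift {g : V ⊕ Fin 4 → V ⊕ Fin 4} {f : V → V} {cx ca cb : Option (Fin 4)}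
    {r : Fin 4 → V ⊕ Fin 4} (hxa : x ≠ a) (hxb : x ≠ b) (hab : a ≠ b)
    (hx : g (inl x) = (cx.map inr).getD (inl (f x)))
    (ha : g (inl a) = (ca.map inr).getD (inl (f a)))
    (hb : g (inl b) = (cb.map inr).getD (inl (f b)))
    (h : ∀ v, v ≠ x → v ≠ a → v ≠ b → g (inl v) = inl (f v))
    (h0 : g (inr 0) = r 0) (h1 : g (inr 1) = r 1) (h2 : g (inr 2) = r 2)
    (h3 : g (inr 3) = r 3) : g = lift x a b f cx ca cb r := by
  funext u
  rcases u with v | i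
  · by_cases h1 : v = x
    · subst h1; simpa [lift] using hx
    by_cases h2 : v = a
    · subst h2; simpa [lift, hxa.symm] using ha
    by_cases h3 : v = b
    · subst h3; simpa [lift, hxb.symm, hab.symm] using hb
    simpa [lift, h1, h2, h3] using h v h1 h2 h3
  · fin_cases i <;> assumption

lemma inl_project {g : V ⊕ Fin 4 → V ⊕ Fin 4} {p q v : V} (hp : v ≠ p) (hq : v ≠ q)
    (h : ∃ w, g (inl v) = inl w) : g (inl v) = inl (project g p q v) := by
  obtain ⟨w, hw⟩ := h
  simp [project, hp, hq, hw]

/-- The converse of the six lifting lemmas: uniqueness of a matching in the expansion is thereby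
reduced to uniqueness in `G`. -/
lemma IsPM.exists_lift {g : V ⊕ Fin 4 → V ⊕ Fin 4} (hg : IsPM (expand G x a b) g)
    (hxa : G.Adj x a) (hxb : G.Adj x b) (hab : G.Adj a b) :
    ∃ f, IsPM G f ∧
      ((f a = b ∧ g = liftX x a b f) ∨
      (f x = b ∧ (g = liftA x a b f ∨ g = liftA' x a b f)) ∨
      (f x = a ∧ (g = liftB x a b f ∨ g = liftB' x a b f)) ∨
      (f x ≠ a ∧ f x ≠ b ∧ f a ≠ b ∧ g = liftL x a b f)) := by
  have n1 := hxa.ne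
  have n2 := hxb.ne
  have n3 := hab.ne
  have E := hg.eq_inl_or
  have I := fun {u v} (h : g u = v) => show g v = u from h ▸ hg.invol u
  rcases hg.expand_cases n1 n2 with
    ⟨h0, h1, h3⟩ | ⟨h0, h2, h3⟩ | ⟨h0, h1, h3⟩ | ⟨h0, h1, h2⟩ | ⟨h0, h1, h3⟩ | ⟨h0, h2⟩
  · have J : ∀ v, v ≠ a → v ≠ b → ∃ w, g (inl v) = inl w := fun v h h' => by
      rcases E v with h'' | ⟨rfl, h'' | h''⟩ | ⟨rfl, h'' | h''⟩ | ⟨rfl, h'' | h''⟩ <;>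
        first | exact h'' | simp_all [I h0]
    refine ⟨project g a b, isPM_project hg hab ⟨_, I h1⟩ ⟨_, I h3⟩ J,
      Or.inl ⟨by simp [project], ?_⟩⟩
    exact eq_lift n1 n2 n3 (inl_project (by tauto) (by tauto) (J x (by tauto) (by tauto))) (I h1)
      (I h3)
      (fun v _ _ _ => inl_project (by tauto) (by tauto) (J v (by tauto) (by tauto)))
      h0 h1 (I h0) h3
  · have J : ∀ v, v ≠ x → v ≠ b → ∃ w, g (inl v) = inl w := fun v h h' => by
      rcases E v with h'' | ⟨rfl, h'' | h''⟩ | ⟨rfl, h'' | h''⟩ | ⟨rfl, h'' | h''⟩ <;>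
        first | exact h'' | simp_all [I h0]
    refine ⟨project g x b, isPM_project hg hxb ⟨_, I h3⟩ ⟨_, I h2⟩ J,
      Or.inr (Or.inl ⟨by simp [project], Or.inl ?_⟩)⟩
    exact eq_lift n1 n2 n3 (I h3) (inl_project (by tauto) (by tauto) (J a (by tauto) (by tauto)))
      (I h2)
      (fun v _ _ _ => inl_project (by tauto) (by tauto) (J v (by tauto) (by tauto)))
      h0 (I h0) h2 h3
  · have J : ∀ v, v ≠ x → v ≠ b → ∃ w, g (inl v) = inl w := fun v h h' => by
      rcases E v with h'' | ⟨rfl, h'' | h''⟩ | ⟨rfl, h'' | h''⟩ | ⟨rfl, h'' | h''⟩ <;>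
        first | exact h'' | simp_all [I h0]
    refine ⟨project g x b, isPM_project hg hxb ⟨_, I h1⟩ ⟨_, I h3⟩ J,
      Or.inr (Or.inl ⟨by simp [project], Or.inr ?_⟩)⟩
    exact eq_lift n1 n2 n3 (I h1) (inl_project (by tauto) (by tauto) (J a (by tauto) (by tauto)))
      (I h3)
      (fun v _ _ _ => inl_project (by tauto) (by tauto) (J v (by tauto) (by tauto)))
      h0 h1 (I h0) h3
  · have J : ∀ v, v ≠ x → v ≠ a → ∃ w, g (inl v) = inl w := fun v h h' => by
      rcases E v with h'' | ⟨rfl, h'' | h''⟩ | ⟨rfl, h'' | h''⟩ | ⟨rfl, h'' | h''⟩ <;>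
        first | exact h'' | simp_all [I h2]
    refine ⟨project g x a, isPM_project hg hxa ⟨_, I h1⟩ ⟨_, I h0⟩ J,
      Or.inr (Or.inr (Or.inl ⟨by simp [project], Or.inl ?_⟩))⟩
    exact eq_lift n1 n2 n3 (I h1) (I h0)
      (inl_project (by tauto) (by tauto) (J b (by tauto) (by tauto)))
      (fun v _ _ _ => inl_project (by tauto) (by tauto) (J v (by tauto) (by tauto)))
      h0 h1 h2 (I h2)
  · have J : ∀ v, v ≠ x → v ≠ a → ∃ w, g (inl v) = inl w := fun v h h' => by
      rcases E v with h'' | ⟨rfl, h'' | h''⟩ | ⟨rfl, h'' | h''⟩ | ⟨rfl, h'' | h''⟩ <;>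
        first | exact h'' | simp_all [I h0]
    refine ⟨project g x a, isPM_project hg hxa ⟨_, I h3⟩ ⟨_, I h1⟩ J,
      Or.inr (Or.inr (Or.inl ⟨by simp [project], Or.inr ?_⟩))⟩
    exact eq_lift n1 n2 n3 (I h3) (I h1)
      (inl_project (by tauto) (by tauto) (J b (by tauto) (by tauto)))
      (fun v _ _ _ => inl_project (by tauto) (by tauto) (J v (by tauto) (by tauto)))
      h0 h1 (I h0) h3
  · have J : ∀ v, ∃ w, g (inl v) = inl w := fun v => by
      rcases E v with h'' | ⟨rfl, h'' | h''⟩ | ⟨rfl, h'' | h''⟩ | ⟨rfl, h'' | h''⟩ <;>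
        first | exact h'' | simp_all [I h0, I h2]
    have K : ∀ v, g (inl v) = inl ((g (inl v)).elim id fun _ => v) := fun v => by
      obtain ⟨w, hw⟩ := J v
      simp [hw]
    -- The expansion has no edge between two of `x`, `a`, `b`, so a matching that pairs old vertices
    -- only with old ones avoids the triangle.
    have N : ∀ {p q}, (p = x ∨ p = a ∨ p = b) → (q = x ∨ q = a ∨ q = b) →
        (g (inl p)).elim id (fun _ => p) ≠ q := fun {p q} hp hq e => by
      have h1 := hg.adj (inl p)
      rw [K p, e] at h1
      exact h1.2 ⟨hp, hq⟩
    exact ⟨_, isPM_project_self hg J, Or.inr (Or.inr (Or.inr ⟨N (by simp) (by simp),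
      N (by simp) (by simp), N (by simp) (by simp), eq_lift n1 n2 n3 (K x) (K a) (K b)
      (fun v _ _ _ => K v) h0 (I h0) h2 (I h2)⟩))⟩

end Expand
-- Seeds; cubicity, connectivity and inherited matchings of the expansion
/-- A `3`-connected cubic graph with an isolated triangle `xab` such that `xa` and the members
of `F` are its lonely edges, those of `F` lie in a perfect matching containing `ab`, and some
perfect matching avoids the triangle. -/
structure IsSeed {V : Type*} (G : SimpleGraph V) (x a b : V) (F : Set (Sym2 V)) : Prop where
  cubic : Cubic G
  conn3 : Conn3 G
  adj_xa : G.Adj x a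
  adj_xb : G.Adj x b
  adj_ab : G.Adj a b
  common_xa : ∀ w, G.Adj x w → G.Adj a w → w = b
  common_xb : ∀ w, G.Adj x w → G.Adj b w → w = a
  common_ab : ∀ w, G.Adj a w → G.Adj b w → w = x
  inOne : InOne G x a
  inOne_of_mem : ∀ p q, s(p, q) ∈ F →
    ∃ f, IsPM G f ∧ f p = q ∧ f a = b ∧ ∀ g, IsPM G g → g p = q → g = f
  notMem : s(a, b) ∉ F
  inTwo : ∀ p q, G.Adj p q → s(p, q) ≠ s(x, a) → s(p, q) ∉ F → InTwo G p q
  exists_outer : ∃ f, IsPM G f ∧ f x ≠ a ∧ f x ≠ b ∧ f a ≠ b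

section Step

variable {V : Type*} {G : SimpleGraph V} {x a b : V}

lemma expand_cubic (h : Cubic G) (hxa : G.Adj x a) (hxb : G.Adj x b) (hab : G.Adj a b) :
    Cubic (expand G x a b) := by
  have n1 := hxa.ne
  have n2 := hxb.ne
  have n3 := hab.ne
  rintro (v | i)
  · by_cases hx : v = x
    · subst hx
      obtain ⟨r, hr, hr', h⟩ := h.exists_third hxa hxb n3
      have hv := ((h r).2 (by simp)).ne'
      refine ⟨inl r, inr 1, inr 3, by simp, by simp, by simp, ?_⟩
      rintro (w | i) <;> simp [h] <;> grind
    by_cases ha : v = a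
    · subst ha
      obtain ⟨r, hr, hr', h⟩ := h.exists_third hxa.symm hab n2
      have hv := ((h r).2 (by simp)).ne'
      refine ⟨inl r, inr 0, inr 1, by simp, by simp, by simp, ?_⟩
      rintro (w | i) <;> simp [h] <;> grind
    by_cases hb : v = b
    · subst hb
      obtain ⟨r, hr, hr', h⟩ := h.exists_third hxb.symm hab.symm n1
      have hv := ((h r).2 (by simp)).ne'
      refine ⟨inl r, inr 2, inr 3, by simp, by simp, by simp, ?_⟩
      rintro (w | i) <;> simp [h] <;> grind
    · obtain ⟨p, q, r, h1, h2, h3, h4⟩ := h v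
      refine ⟨inl p, inl q, inl r, by simpa, by simpa, by simpa, ?_⟩
      rintro (w | i)
      · simp [h4, hx, ha, hb]
      · simp [hx, ha, hb]
  · fin_cases i
    · refine ⟨inl a, inr 1, inr 2, by simp, by simp, by simp, ?_⟩
      rintro (w | i) <;> simp
    · refine ⟨inl x, inl a, inr 0, by simp [n1], by simp, by simp, ?_⟩
      rintro (w | i) <;> simp
    · refine ⟨inl b, inr 3, inr 0, by simp, by simp, by simp, ?_⟩
      rintro (w | i) <;> simp
    · refine ⟨inl x, inl b, inr 2, by simp [n2], by simp, by simp, ?_⟩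
      rintro (w | i) <;> simp

/-- Contract the two new triangles. -/
def contract (a b : V) : V ⊕ Fin 4 → V :=
  Sum.elim id ![a, a, b, b]

-- `P` stands for "reaches a safe old vertex", one that survives and is not the contraction of a
-- deleted vertex. Only the gadget matters, so a finite check over the positions of `s`, `t`, `u`
-- suffices; the outer neighbours `a'` and `b'` serve as exits.
set_option maxHeartbeats 1000000 in
lemma exists_walk_to_old {a' b' : V} (hxa : x ≠ a) (hxb : x ≠ b) (hab : a ≠ b)
    (ha1 : a' ≠ x) (ha2 : a' ≠ b) (ha3 : a' ≠ a) (hb1 : b' ≠ x) (hb2 : b' ≠ a) (hb3 : b' ≠ b)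
    (haa : G.Adj a a') (hbb : G.Adj b b') (s t : V ⊕ Fin 4) (P : V ⊕ Fin 4 → Prop)
    (h : ∀ p, inl p ≠ s → inl p ≠ t → p ≠ contract a b s → p ≠ contract a b t → P (inl p))
    (hP : ∀ u v, (expand G x a b).Adj u v → u ≠ s → u ≠ t → P v → P u) (u : V ⊕ Fin 4)
    (hs : u ≠ s) (ht : u ≠ t) : P u := by
  have e1 := hP (inl a) (inl a') (by simp [*])
  have e2 := hP (inl a) (inr 0) (by simp [*])
  have e3 := hP (inl a) (inr 1) (by simp [*])
  have e4 := hP (inr 0) (inl a) (by simp [*])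
  have e5 := hP (inr 0) (inr 1) (by simp [*])
  have e6 := hP (inr 0) (inr 2) (by simp [*])
  have e7 := hP (inr 1) (inl a) (by simp [*])
  have e8 := hP (inr 1) (inl x) (by simp [*])
  have e9 := hP (inr 1) (inr 0) (by simp [*])
  have f1 := hP (inl b) (inl b') (by simp [*])
  have f2 := hP (inl b) (inr 2) (by simp [*])
  have f3 := hP (inl b) (inr 3) (by simp [*])
  have f4 := hP (inr 2) (inl b) (by simp [*])
  have f5 := hP (inr 2) (inr 3) (by simp [*])
  have f6 := hP (inr 2) (inr 0) (by simp [*])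
  have f7 := hP (inr 3) (inl b) (by simp [*])
  have f8 := hP (inr 3) (inl x) (by simp [*])
  have f9 := hP (inr 3) (inr 2) (by simp [*])
  have ga := h a
  have ga' := h a'
  have gb := h b
  have gb' := h b'
  have gx := h x
  clear hP
  rcases u with u | k
  · have gu := h u
    clear h
    rcases s with s | i
    · rcases t with t | j
      · simp_all [contract]
      · fin_cases j <;> (try simp [contract] at *) <;>
          grind +splitImp (splits := 20)
    · rcases t with t | j
      · fin_cases i <;> (try simp [contract] at *) <;>
          grind +splitImp (splits := 20)
      · fin_cases i <;> fin_cases j <;> (try simp [contract] at *) <;>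
          grind +splitImp (splits := 20)
  · clear h
    rcases s with s | i
    · rcases t with t | j
      · fin_cases k <;> (try simp [contract] at *) <;>
          grind +splitImp (splits := 20)
      · fin_cases k <;> fin_cases j <;> (try simp [contract] at *) <;>
          grind +splitImp (splits := 20)
    · rcases t with t | j
      · fin_cases k <;> fin_cases i <;> (try simp [contract] at *) <;>
          grind +splitImp (splits := 20)
      · fin_cases k <;> fin_cases i <;> fin_cases j <;> (try simp [contract] at *) <;>
          grind +splitImp (splits := 20)

/-- Contracting the two new triangles turns the deleted pair into at most two deleted vertices of
`G`. Walks of `G` avoiding these lift to the expansion, and every surviving vertex reaches an old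
vertex where such a walk can start. -/
lemma expand_conn3 (h : Cubic G) (hc : Conn3 G) (hxa : G.Adj x a) (hxb : G.Adj x b)
    (hab : G.Adj a b) : Conn3 (expand G x a b) := by
  have n1 := hxa.ne
  have n2 := hxb.ne
  have n3 := hab.ne
  obtain ⟨a', ha1, ha2, ha⟩ := h.exists_third hxa.symm hab n2
  obtain ⟨b', hb1, hb2, hb⟩ := h.exists_third hxb.symm hab.symm n1
  have ha3 : a' ≠ a := ((ha a').2 (by simp)).ne'
  have hb3 : b' ≠ b := ((hb b').2 (by simp)).ne'
  have haa : G.Adj a a' := (ha a').2 (by simp)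
  have hbb : G.Adj b b' := (hb b').2 (by simp)
  intro s t u v hus hut hvs hvt
  set H := AdjAvoiding (expand G x a b) s t with hH
  have : Std.Symm H := ⟨fun _ _ h => h.symm⟩
  have sym : ∀ {u v}, Relation.ReflTransGen H u v → Relation.ReflTransGen H v u :=
    fun h => Relation.ReflTransGen.stdSymm.symm _ _ h
  have one : ∀ {u v}, (expand G x a b).Adj u v → u ≠ s → u ≠ t → v ≠ s → v ≠ t →
      Relation.ReflTransGen H u v := fun h h1 h2 h3 h4 => .single ⟨h, h1, h2, h3, h4⟩
  have edge : ∀ p q, AdjAvoiding G (contract a b s) (contract a b t) p q →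
      Relation.ReflTransGen H (inl p) (inl q) := by
    have C : ∀ {s p}, p ≠ contract a b s → inl p ≠ s ∧ (p = a → inr 0 ≠ s ∧ inr 1 ≠ s) ∧
        (p = b → inr 2 ≠ s ∧ inr 3 ≠ s) := by
      intro s p h
      refine ⟨?_, ?_, ?_⟩
      · rintro rfl; exact h rfl
      · rintro rfl; constructor <;> (rintro rfl; exact h rfl)
      · rintro rfl; constructor <;> (rintro rfl; exact h rfl)
    rintro p q ⟨hpq, h1, h2, h3, h4⟩
    have c1 := C h1
    have c2 := C h2
    have c3 := C h3
    have c4 := C h4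
    -- A triangle edge is replaced by a detour: `xa` by `x, 1, a`, `xb` by `x, 3, b`, `ab` by `a, 0,
    -- 2, b`. The inner vertices survive because they contract to an end of the edge, which is not
    -- the contraction of `s` or `t`.
    by_cases hT : (p = x ∨ p = a ∨ p = b) ∧ (q = x ∨ q = a ∨ q = b)
    swap
    · exact one ⟨hpq, hT⟩ c1.1 c2.1 c3.1 c4.1
    have hne := hpq.ne
    have xa : ∀ {p q}, p = x → q = a → inl p ≠ s → inl p ≠ t → inl q ≠ s → inl q ≠ t →
        inr 1 ≠ s → inr 1 ≠ t → Relation.ReflTransGen H (inl p) (inl q) := by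
      rintro _ _ rfl rfl h1 h2 h3 h4 h5 h6
      exact (one (v := inr 1) (by simp) h1 h2 h5 h6).trans (one (by simp) h5 h6 h3 h4)
    have xb : ∀ {p q}, p = x → q = b → inl p ≠ s → inl p ≠ t → inl q ≠ s → inl q ≠ t →
        inr 3 ≠ s → inr 3 ≠ t → Relation.ReflTransGen H (inl p) (inl q) := by
      rintro _ _ rfl rfl h1 h2 h3 h4 h5 h6
      exact (one (v := inr 3) (by simp) h1 h2 h5 h6).trans (one (by simp) h5 h6 h3 h4)
    have ab : ∀ {p q}, p = a → q = b → inl p ≠ s → inl p ≠ t → inl q ≠ s → inl q ≠ t →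
        inr 0 ≠ s → inr 0 ≠ t → inr 2 ≠ s → inr 2 ≠ t →
        Relation.ReflTransGen H (inl p) (inl q) := by
      rintro _ _ rfl rfl h1 h2 h3 h4 h5 h6 h7 h8
      exact (one (v := inr 0) (by simp) h1 h2 h5 h6).trans
        ((one (v := inr 2) (by simp) h5 h6 h7 h8).trans (one (by simp) h7 h8 h3 h4))
    obtain ⟨rfl | rfl | rfl, rfl | rfl | rfl⟩ := hT
    · exact absurd rfl hne
    · exact xa rfl rfl c1.1 c2.1 c3.1 c4.1 (c3.2.1 rfl).2 (c4.2.1 rfl).2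
    · exact xb rfl rfl c1.1 c2.1 c3.1 c4.1 (c3.2.2 rfl).2 (c4.2.2 rfl).2
    · exact sym (xa rfl rfl c3.1 c4.1 c1.1 c2.1 (c1.2.1 rfl).2 (c2.2.1 rfl).2)
    · exact absurd rfl hne
    · exact ab rfl rfl c1.1 c2.1 c3.1 c4.1 (c1.2.1 rfl).1 (c2.2.1 rfl).1
        (c3.2.2 rfl).1 (c4.2.2 rfl).1
    · exact sym (xb rfl rfl c3.1 c4.1 c1.1 c2.1 (c1.2.2 rfl).2 (c2.2.2 rfl).2)
    · exact sym (ab rfl rfl c3.1 c4.1 c1.1 c2.1 (c3.2.1 rfl).1 (c4.2.1 rfl).1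
        (c1.2.2 rfl).1 (c2.2.2 rfl).1)
    · exact absurd rfl hne
  have walk : ∀ p q, p ≠ contract a b s → p ≠ contract a b t → q ≠ contract a b s →
      q ≠ contract a b t → Relation.ReflTransGen H (inl p) (inl q) := by
    intro p q h1 h2 h3 h4
    have := hc _ _ p q h1 h2 h3 h4
    clear h3 h4
    induction this with
    | refl => exact .refl
    | tail _ hbc ih => exact ih.trans (edge _ _ hbc)
  have toOld : ∀ u, u ≠ s → u ≠ t → ∃ p, p ≠ contract a b s ∧ p ≠ contract a b t ∧
      Relation.ReflTransGen H u (inl p) := by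
    have := exists_walk_to_old (x := x) (a := a) (b := b) (a' := a') (b' := b') n1 n2 n3
      ha1 ha2 ha3 hb1 hb2 hb3 haa hbb s t (fun u => u ≠ s ∧ u ≠ t ∧ ∃ p, p ≠ contract a b s ∧
        p ≠ contract a b t ∧ Relation.ReflTransGen H u (inl p))
      (fun p h1 h2 h3 h4 => ⟨h1, h2, p, h3, h4, .refl⟩)
      (fun u v huv h1 h2 ⟨h3, h4, p, h5, h6, h7⟩ =>
        ⟨h1, h2, p, h5, h6, (one huv h1 h2 h3 h4).trans h7⟩)
    exact fun u h1 h2 => (this u h1 h2).2.2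
  obtain ⟨p, hp1, hp2, hp⟩ := toOld u hus hut
  obtain ⟨q, hq1, hq2, hq⟩ := toOld v hvs hvt
  exact hp.trans ((walk p q hp1 hp2 hq1 hq2).trans (sym hq))

/-- One lift per matching, described uniformly: edges of the matching outside the triangle are kept,
and the ends of a matched triangle edge move to new vertices. This is enough to recover the matching
from its lift. -/
lemma exists_canonical_lift {f : V → V} (hf : IsPM G f) (hxa : x ≠ a) (hxb : x ≠ b)
    (hab : a ≠ b) : ∃ g, IsPM (expand G x a b) g ∧ ∀ v,
      (¬ ((v = x ∨ v = a ∨ v = b) ∧ (f v = x ∨ f v = a ∨ f v = b)) → g (inl v) = inl (f v)) ∧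
      ((v = x ∨ v = a ∨ v = b) ∧ (f v = x ∨ f v = a ∨ f v = b) → ∃ i, g (inl v) = inr i) := by
  have I := hf.invol
  have N := fun v => (hf.adj v).ne'
  by_cases h1 : f a = b
  · refine ⟨_, isPM_liftX hf hxa hxb hab h1, fun v => ?_⟩
    unfold liftX lift
    grind
  by_cases h2 : f x = b
  · refine ⟨_, isPM_liftA hf hxa hxb hab h2, fun v => ?_⟩
    unfold liftA lift
    grind
  by_cases h3 : f x = a
  · refine ⟨_, isPM_liftB hf hxa hxb hab h3, fun v => ?_⟩
    unfold liftB lift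
    grind
  · refine ⟨_, isPM_liftL hf hxa hxb hab h3 h2 h1, fun v => ?_⟩
    unfold liftL lift
    grind

lemma inTwo_inl {p q : V} (h : InTwo G p q) (hxa : x ≠ a) (hxb : x ≠ b)
    (hab : a ≠ b) (hpq : ¬ ((p = x ∨ p = a ∨ p = b) ∧ (q = x ∨ q = a ∨ q = b))) :
    InTwo (expand G x a b) (inl p) (inl q) := by
  obtain ⟨f, g, hne, hf, hg, e, e'⟩ := h
  obtain ⟨f', hf', Hf⟩ := exists_canonical_lift hf hxa hxb hab
  obtain ⟨g', hg', Hg⟩ := exists_canonical_lift hg hxa hxb hab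
  refine ⟨f', g', ?_, hf', hg', e ▸ (Hf p).1 (by rwa [e]), e' ▸ (Hg p).1 (by rwa [e'])⟩
  rintro rfl
  apply hne
  have I := hf.invol
  have N := fun v => (hf.adj v).ne'
  have I' := hg.invol
  have N' := fun v => (hg.adj v).ne'
  funext v
  have Hv := Hf v
  have Hv' := Hg v
  by_cases c : (v = x ∨ v = a ∨ v = b) ∧ (f v = x ∨ f v = a ∨ f v = b)
  · obtain ⟨i, hi⟩ := Hv.2 c
    have c' : (v = x ∨ v = a ∨ v = b) ∧ (g v = x ∨ g v = a ∨ g v = b) := by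
      by_contra c'
      simp [Hv'.1 c'] at hi
    by_contra hfg
    have h1 := Hf (f v)
    have h2 := Hg (f v)
    rw [hf.invol] at h1
    obtain ⟨j, hj⟩ := h1.2 ⟨c.2, c.1⟩
    -- If `f` and `g` differ at `v`, then `v`, `f v`, `g v` are the three vertices of the triangle,
    -- and `g` already pairs `v` with `g v`; so `g` matches `f v` outside the triangle.
    have h3 : ¬ (g (f v) = x ∨ g (f v) = a ∨ g (f v) = b) := by
      have e1 : g (f v) ≠ v := fun h => hfg (by rw [← I' (f v), h])
      have e2 : g (f v) ≠ g v := fun h => N v (by rw [← I' (f v), h, I' v])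
      have e3 := N v
      have e4 := N' v
      have e5 := N' (f v)
      clear h1 h2 Hf Hg Hv Hv'
      grind
    have := h2.1 (fun h => h3 h.2)
    simp [hj] at this
  · have h1 := Hv.1 c
    have c' : ¬ ((v = x ∨ v = a ∨ v = b) ∧ (g v = x ∨ g v = a ∨ g v = b)) := by
      intro c'
      obtain ⟨i, hi⟩ := Hv'.2 c'
      simp [h1] at hi
    have h2 := Hv'.1 c'
    rw [h1] at h2
    exact inl_injective h2

end Step

/-! ### The expansion of a seed is a seed -/

section Step

variable {V : Type*} {G : SimpleGraph V} {x a b : V} {F : Set (Sym2 V)}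

/-- Two different matchings through `pq` differ at some vertex other than `p` and `q`, where the
lifts still show the difference. -/
lemma lift_ne {f g : V → V} {p q : V} (hf : IsPM G f) (hg : IsPM G g)
    (hfp : f p = q) (hgp : g p = q) (hne : f ≠ g) {f' g' : V ⊕ Fin 4 → V ⊕ Fin 4}
    (hf' : ∀ v, v ≠ p → v ≠ q → f' (inl v) = inl (f v))
    (hg' : ∀ v, v ≠ p → v ≠ q → g' (inl v) = inl (g v)) : f' ≠ g' := by
  rintro rfl
  apply hne
  have hfq : f q = p := hfp ▸ hf.invol p
  have hgq : g q = p := hgp ▸ hg.invol p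
  funext v
  by_cases h1 : v = p
  · rw [h1, hfp, hgp]
  by_cases h2 : v = q
  · rw [h2, hfq, hgq]
  have := hf' v h1 h2
  rw [hg' v h1 h2] at this
  exact (inl_injective this).symm

lemma InTwo.liftA (h : InTwo G x b) (hxa : x ≠ a) (hxb : x ≠ b) (hab : a ≠ b)
    {u v : V ⊕ Fin 4} (huv : ∀ f : V → V, f x = b → f b = x → liftA x a b f u = v) :
    InTwo (expand G x a b) u v := by
  obtain ⟨f, g, hne, hf, hg, e, e'⟩ := h
  have i : f b = x := e ▸ hf.invol x
  have i' : g b = x := e' ▸ hg.invol x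
  refine ⟨_, _, lift_ne hf hg e e' hne ?_ ?_, isPM_liftA hf hxa hxb hab e,
    isPM_liftA hg hxa hxb hab e', huv f e i, huv g e' i'⟩ <;>
  · intro v h1 h2
    unfold LonelyEdges.liftA lift
    grind

lemma InTwo.liftA' (h : InTwo G x b) (hxa : x ≠ a) (hxb : x ≠ b) (hab : a ≠ b)
    {u v : V ⊕ Fin 4} (huv : ∀ f : V → V, f x = b → f b = x → liftA' x a b f u = v) :
    InTwo (expand G x a b) u v := by
  obtain ⟨f, g, hne, hf, hg, e, e'⟩ := h
  have i : f b = x := e ▸ hf.invol x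
  have i' : g b = x := e' ▸ hg.invol x
  refine ⟨_, _, lift_ne hf hg e e' hne ?_ ?_, isPM_liftA' hf hxa hxb hab e,
    isPM_liftA' hg hxa hxb hab e', huv f e i, huv g e' i'⟩ <;>
  · intro v h1 h2
    unfold LonelyEdges.liftA' lift
    grind

/-- The matching of a member of `F` contains `ab`, so `xb` is not in `F`. The two matchings through
`xb`, with their lifts `liftA` and `liftA'`, cover most edges of the gadget twice. -/
lemma IsSeed.inTwo_xb (h : IsSeed G x a b F) : InTwo G x b := by
  refine h.inTwo x b h.adj_xb ?_ ?_
  · have := h.adj_ab.ne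
    have := h.adj_xb.ne
    grind
  · intro hF
    obtain ⟨f, hf, e, e', -⟩ := h.inOne_of_mem _ _ hF
    have := hf.invol x
    have := hf.invol a
    have := h.adj_xa.ne
    grind

lemma IsSeed.inTwo_ab (h : IsSeed G x a b F) : InTwo G a b := by
  refine h.inTwo a b h.adj_ab ?_ h.notMem
  have := h.adj_ab.ne
  have := h.adj_xb.ne
  grind

lemma IsSeed.inTwo_link (h : IsSeed G x a b F) {p : V} {i : Fin 4}
    (hpi : (expand G x a b).Adj (inl p) (inr i))
    (hne : s(inl p, inr i) ≠ s(inr 0, inl a)) : InTwo (expand G x a b) (inl p) (inr i) := by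
  have n1 := h.adj_xa.ne
  have n2 := h.adj_xb.ne
  have n3 := h.adj_ab.ne
  have hxb := h.inTwo_xb
  rcases hpi with ⟨rfl, rfl | rfl⟩ | ⟨rfl, rfl | rfl⟩ | ⟨rfl, rfl | rfl⟩
  · exact hxb.liftA' n1 n2 n3 fun f _ _ => by simp [liftA', lift]
  · exact hxb.liftA n1 n2 n3 fun f _ _ => by simp [liftA, lift]
  · simp at hne
  -- The edge `a1` is in neither kind of lift from `xb`; it lies in a `liftX` and in a `liftB'`,
  -- told apart by the mate of `3`.
  · obtain ⟨f, -, -, hf, -, e, -⟩ := h.inTwo_ab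
    obtain ⟨g, hg, e', -⟩ := h.inOne
    refine ⟨_, _, ?_, isPM_liftX hf n1 n2 n3 e, isPM_liftB' hg n1 n2 n3 e', ?_, ?_⟩
    · intro h
      have := congrFun h (inr 3)
      simp [liftX, liftB', lift, n2.symm] at this
    · simp [liftX, lift, n1.symm]
    · simp [liftB', lift, n1.symm]
  · exact hxb.liftA n1 n2 n3 fun f _ _ => by simp [liftA, lift, n2.symm, n3.symm]
  · exact hxb.liftA' n1 n2 n3 fun f _ _ => by simp [liftA', lift, n2.symm, n3.symm]

lemma IsSeed.inTwo_new (h : IsSeed G x a b F) {i j : Fin 4}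
    (hij : (expand G x a b).Adj (inr i) (inr j)) : InTwo (expand G x a b) (inr i) (inr j) := by
  have n1 := h.adj_xa.ne
  have n2 := h.adj_xb.ne
  have n3 := h.adj_ab.ne
  have hxb := h.inTwo_xb
  have h01 : InTwo (expand G x a b) (inr 0) (inr 1) :=
    hxb.liftA n1 n2 n3 fun f _ _ => by simp [liftA, lift]
  have h02 : InTwo (expand G x a b) (inr 0) (inr 2) :=
    hxb.liftA' n1 n2 n3 fun f _ _ => by simp [liftA', lift]
  -- Only `liftL` and `liftB` contain `23`. As `xa` is lonely, `liftB` gives just one matching; the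
  -- second is why a seed needs a matching that avoids its triangle.
  have h23 : InTwo (expand G x a b) (inr 2) (inr 3) := by
    obtain ⟨f, hf, e1, e2, e3⟩ := h.exists_outer
    obtain ⟨g, hg, e', -⟩ := h.inOne
    refine ⟨_, _, ?_, isPM_liftL hf n1 n2 n3 e1 e2 e3, isPM_liftB hg n1 n2 n3 e', ?_, ?_⟩
    · intro h
      have := congrFun h (inr 0)
      simp [liftL, liftB, lift] at this
    · simp [liftL, lift]
    · simp [liftB, lift]
  rcases hij with ⟨rfl, rfl⟩ | ⟨rfl, rfl⟩ | ⟨rfl, rfl⟩ | ⟨rfl, rfl⟩ | ⟨rfl, rfl⟩ | ⟨rfl, rfl⟩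
  exacts [h01, h01.symm, h23, h23.symm, h02, h02.symm]

theorem IsSeed.expand (h : IsSeed G x a b F) :
    IsSeed (expand G x a b) (inr 0) (inl a) (inr 1) (Sym2.map inl '' F) := by
  have n1 := h.adj_xa.ne
  have n2 := h.adj_xb.ne
  have n3 := h.adj_ab.ne
  refine
    { cubic := expand_cubic h.cubic h.adj_xa h.adj_xb h.adj_ab
      conn3 := expand_conn3 h.cubic h.conn3 h.adj_xa h.adj_xb h.adj_ab
      adj_xa := by simp
      adj_xb := by simp
      adj_ab := by simp
      common_xa := ?_
      common_xb := ?_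
      common_ab := ?_
      inOne := ?_
      inOne_of_mem := ?_
      notMem := by rintro ⟨e, -, he⟩; induction e; simp at he
      inTwo := ?_
      exists_outer := ?_ }
  · rintro (w | i) <;> simp [n3] <;> grind
  · rintro (w | i) <;> simp <;> grind
  · rintro (w | i) <;> simp; grind
  · obtain ⟨f, hf, e, hu⟩ := h.inOne
    refine ⟨_, isPM_liftB hf n1 n2 n3 e, by simp [liftB, lift], fun g hg hg0 => ?_⟩
    obtain ⟨f', hf', ⟨-, rfl⟩ | ⟨-, rfl | rfl⟩ | ⟨e', rfl | rfl⟩ | ⟨-, -, -, rfl⟩⟩ :=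
      hg.exists_lift h.adj_xa h.adj_xb h.adj_ab
    · simp [liftX, lift] at hg0
    · simp [liftA, lift] at hg0
    · simp [liftA', lift] at hg0
    · rw [hu f' hf' e']
    · simp [liftB', lift] at hg0
    · simp [liftL, lift] at hg0
  · rintro p' q' ⟨e, he, he'⟩
    obtain ⟨p, q, rfl, rfl, hF⟩ : ∃ p q, inl p = p' ∧ inl q = q' ∧ s(p, q) ∈ F := by
      induction e with
      | _ p q =>
        simp only [Sym2.map_mk, Sym2.eq_iff] at he'
        rcases he' with ⟨h1, h2⟩ | ⟨h1, h2⟩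
        · exact ⟨p, q, h1, h2, he⟩
        · exact ⟨q, p, h2, h1, Sym2.eq_swap ▸ he⟩
    obtain ⟨f, hf, e, hab, hu⟩ := h.inOne_of_mem p q hF
    have hba : f b = a := hab ▸ hf.invol a
    have hp : p ≠ a ∧ p ≠ b := by
      constructor
      · rintro rfl
        rw [hab] at e
        subst e
        exact h.notMem hF
      · rintro rfl
        rw [hba] at e
        subst e
        exact h.notMem (Sym2.eq_swap ▸ hF)
    refine ⟨_, isPM_liftX hf n1 n2 n3 hab, ?_, by simp [liftX, lift, n1.symm], fun g hg hgp => ?_⟩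
    · simp [liftX, lift, hp.1, hp.2, e]
    obtain ⟨f', hf', h'⟩ := hg.exists_lift h.adj_xa h.adj_xb h.adj_ab
    -- Since `p` is neither `a` nor `b`, only `p = x` could have its mate changed by a lift, and
    -- then the mate would be a new vertex, not `q`.
    have hfp : f' p = q := by
      rcases h' with ⟨-, rfl⟩ | ⟨-, rfl | rfl⟩ | ⟨e', rfl | rfl⟩ | ⟨-, -, -, rfl⟩ <;>
        by_cases hpx : p = x <;>
        simp_all [liftX, liftA, liftA', liftB, liftB', liftL, lift]
    obtain rfl := hu f' hf' hfp
    rcases h' with ⟨-, rfl⟩ | ⟨e', -⟩ | ⟨e', -⟩ | ⟨-, -, e', -⟩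
    · rfl
    · have := hf.invol x
      rw [e', hba] at this
      exact absurd this.symm n1
    · have := hf.invol x
      rw [e', hab] at this
      exact absurd this.symm n2
    · exact absurd hab e'
  · rintro (p | i) (q | j) hpq hne hF
    · have hF' : s(p, q) ∉ F := fun h' => hF ⟨_, h', rfl⟩
      refine inTwo_inl (h.inTwo p q hpq.1 ?_ hF') n1 n2 n3 hpq.2
      have := hpq.2
      grind
    · exact h.inTwo_link hpq hne
    · exact (h.inTwo_link hpq.symm (by rwa [Sym2.eq_swap])).symm
    · exact h.inTwo_new hpq
  -- `liftA'` uses all three edges leaving `{a, 0, 1}`: `02`, `1x` and the outer edge at `a`.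
  · obtain ⟨f, -, -, hf, -, e, -⟩ := h.inTwo_xb
    refine ⟨_, isPM_liftA' hf n1 n2 n3 e, ?_, ?_, ?_⟩ <;> simp [liftA', lift, n1.symm]

end Step

/-! ### Counting triangles in the expansion -/

section Triangles

variable {V : Type*} {G : SimpleGraph V} {x a b : V} {F : Set (Sym2 V)}

/-- Because no edge of `xab` lies in a second triangle, removing its three edges destroys no other
triangle. -/
lemma IsSeed.third_eq (h : IsSeed G x a b F) {p q r : V} (hpq : G.Adj p q) (hpr : G.Adj p r)
    (hqr : G.Adj q r) (hp : p = x ∨ p = a ∨ p = b) (hq : q = x ∨ q = a ∨ q = b) (v : V) :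
    v = p ∨ v = q ∨ v = r ↔ v = x ∨ v = a ∨ v = b := by
  have h1 := h.common_xa r
  have h2 := h.common_xb r
  have h3 := h.common_ab r
  have h4 := hpq.ne
  obtain rfl | rfl | rfl := hp <;> obtain rfl | rfl | rfl := hq <;> grind

open Classical in
lemma expand_triangle_inr (hxa : x ≠ a) (hab : a ≠ b) {i : Fin 4}
    {v w : V ⊕ Fin 4} (h1 : (LonelyEdges.expand G x a b).Adj (inr i) v)
    (h2 : (LonelyEdges.expand G x a b).Adj (inr i) w)
    (h3 : (LonelyEdges.expand G x a b).Adj v w) :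
    ({inr i, v, w} : Finset (V ⊕ Fin 4)) = {inl a, inr 0, inr 1} ∨
    ({inr i, v, w} : Finset (V ⊕ Fin 4)) = {inl b, inr 2, inr 3} := by
  rcases v with p | j <;> rcases w with q | k
  · exfalso
    have h4 := h3.2
    simp only [expand_inr_inl] at h1 h2
    grind
  · simp only [expand_inr_inl, expand_inr_inr, expand_inl_inr] at h1 h2 h3
    obtain ⟨rfl, rfl⟩ | ⟨rfl, rfl⟩ | ⟨rfl, rfl⟩ | ⟨rfl, rfl⟩ | ⟨rfl, rfl⟩ | ⟨rfl, rfl⟩ := h2 <;>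
      simp at h1 h3
    · left; subst h1; ext u; simp; tauto
    · left; grind
    · right; grind
    · right; grind
    · grind
    · grind
  · simp only [expand_inr_inl, expand_inr_inr] at h1 h2 h3
    obtain ⟨rfl, rfl⟩ | ⟨rfl, rfl⟩ | ⟨rfl, rfl⟩ | ⟨rfl, rfl⟩ | ⟨rfl, rfl⟩ | ⟨rfl, rfl⟩ := h1 <;>
      simp at h2 h3
    · left; grind
    · left; grind
    · right; grind
    · right; grind
    · grind
    · grind
  · exfalso
    simp only [expand_inr_inr] at h1 h2 h3
    omega

open Classical in
lemma IsSeed.ncard_cliqueSet_expand [Finite V] (h : IsSeed G x a b F) :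
    ((LonelyEdges.expand G x a b).cliqueSet 3).ncard = (G.cliqueSet 3).ncard + 1 := by
  have n1 := h.adj_xa.ne
  have n2 := h.adj_xb.ne
  have n3 := h.adj_ab.ne
  set T : Set (Finset V) := G.cliqueSet 3 \ {{x, a, b}}
  have key : (LonelyEdges.expand G x a b).cliqueSet 3 =
      insert {inl a, inr 0, inr 1} (insert {inl b, inr 2, inr 3}
        ((fun s => s.map Function.Embedding.inl) '' T)) := by
    ext s
    simp only [Set.mem_insert_iff, SimpleGraph.mem_cliqueSet_iff]
    constructor
    · intro hs
      obtain ⟨u, v, w, huv, huw, hvw, rfl⟩ := SimpleGraph.is3Clique_iff.1 hs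
      rcases u with p | i
      · rcases v with q | j
        · rcases w with r | k
          · refine Or.inr (Or.inr ⟨{p, q, r}, ⟨?_, ?_⟩, ?_⟩)
            · exact SimpleGraph.is3Clique_triple_iff.2 ⟨huv.1, huw.1, hvw.1⟩
            · intro e
              have h1 : p ∈ ({x, a, b} : Finset V) := by rw [← e]; simp
              have h2 : q ∈ ({x, a, b} : Finset V) := by rw [← e]; simp
              exact huv.2 ⟨by simpa using h1, by simpa using h2⟩
            · simp
          · have := expand_triangle_inr n1 n3 huw.symm hvw.symm huv
            have e : ({inl p, inl q, inr k} : Finset (V ⊕ Fin 4)) = {inr k, inl p, inl q} := by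
              ext; simp; tauto
            rw [e]
            tauto
        · have := expand_triangle_inr n1 n3 huv.symm hvw huw
          rw [Finset.insert_comm]
          tauto
      · have := expand_triangle_inr n1 n3 huv huw hvw
        tauto
    · rintro (rfl | rfl | ⟨s, ⟨hs, hne⟩, rfl⟩)
      · simp [SimpleGraph.is3Clique_triple_iff]
      · simp [SimpleGraph.is3Clique_triple_iff]
      · obtain ⟨p, q, r, hpq, hpr, hqr, rfl⟩ := SimpleGraph.is3Clique_iff.1 hs
        have H : ∀ {p q r}, G.Adj p q → G.Adj p r → G.Adj q r → ({p, q, r} : Finset V) ≠ {x, a, b} →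
            (LonelyEdges.expand G x a b).Adj (inl p) (inl q) := by
          refine fun {p q r} hpq hpr hqr hne => ⟨hpq, fun hT => hne ?_⟩
          ext v
          simpa using h.third_eq hpq hpr hqr hT.1 hT.2 v
        have e : ({p, q, r} : Finset V) = {p, r, q} := by ext; simp; tauto
        have e' : ({p, q, r} : Finset V) = {q, r, p} := by ext; simp; tauto
        have h1 := H hpq hpr hqr hne
        have h2 := H hpr hpq hqr.symm (e ▸ hne)
        have h3 := H hqr hpq.symm hpr.symm (e' ▸ hne)
        simpa using SimpleGraph.is3Clique_triple_iff.2 ⟨h1, h2, h3⟩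
  have hT : T.ncard + 1 = (G.cliqueSet 3).ncard := by
    refine Set.ncard_sdiff_singleton_add_one ?_ (Set.toFinite _)
    rw [SimpleGraph.mem_cliqueSet_iff, SimpleGraph.is3Clique_triple_iff]
    exact ⟨h.adj_xa, h.adj_xb, h.adj_ab⟩
  have himg : ∀ i, ∀ s : Finset (V ⊕ Fin 4), inr i ∈ s →
      s ∉ ((fun s => s.map Function.Embedding.inl) '' T) := by
    rintro i _ hi ⟨s, -, rfl⟩
    simp at hi
  rw [key, Set.ncard_insert_of_notMem, Set.ncard_insert_of_notMem,
    Set.ncard_image_of_injective _ (Finset.map_injective _)]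
  · omega
  · exact himg 2 _ (by simp)
  · rw [Set.mem_insert_iff, not_or]
    refine ⟨fun e => ?_, himg 0 _ (by simp)⟩
    have : (inr 0 : V ⊕ Fin 4) ∈ ({inl b, inr 2, inr 3} : Finset (V ⊕ Fin 4)) := by
      rw [← e]; simp
    simp at this

end Triangles

/-! ### Checking explicit graphs by computation -/

section Neighbours

variable {n : ℕ}

/-- The graph on `Fin n` with the given lists of neighbours. -/
def ofNbrs (nb : Fin n → List (Fin n)) : SimpleGraph (Fin n) where
  Adj v w := v ≠ w ∧ (w ∈ nb v ∨ v ∈ nb w)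
  symm := ⟨fun _ _ h => ⟨h.1.symm, h.2.symm⟩⟩
  loopless := ⟨fun _ h => h.1 rfl⟩

instance (nb : Fin n → List (Fin n)) : DecidableRel (ofNbrs nb).Adj := fun v w =>
  inferInstanceAs (Decidable (v ≠ w ∧ (w ∈ nb v ∨ v ∈ nb w)))

/-- The lists of neighbours are symmetric and describe a cubic graph. -/
def IsCubicList (nb : Fin n → List (Fin n)) : Prop :=
  ∀ v, (nb v).Nodup ∧ (nb v).length = 3 ∧ ∀ w ∈ nb v, v ≠ w ∧ v ∈ nb w

instance (nb : Fin n → List (Fin n)) : Decidable (IsCubicList nb) := by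
  unfold IsCubicList; infer_instance

variable {nb : Fin n → List (Fin n)}

lemma IsCubicList.adj_iff (h : IsCubicList nb) {v w : Fin n} :
    (ofNbrs nb).Adj v w ↔ w ∈ nb v :=
  ⟨fun e => e.2.elim id fun e => ((h w).2.2 v e).2, fun e => ⟨((h v).2.2 w e).1, Or.inl e⟩⟩

lemma IsCubicList.cubic (h : IsCubicList nb) : Cubic (ofNbrs nb) := by
  intro v
  obtain ⟨h1, h2, -⟩ := h v
  obtain ⟨p, q, r, e⟩ := List.length_eq_three.1 h2
  rw [e] at h1
  simp only [List.nodup_cons, List.mem_cons, not_or] at h1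
  refine ⟨p, q, r, h1.1.1, h1.1.2.1, h1.2.1.1, fun w => ?_⟩
  rw [h.adj_iff, e]
  simp

/-- Depth-first search: the visited vertices, when a stack and a list of vertices which were
visited before are given. -/
def dfs (nb : Fin n → List (Fin n)) : ℕ → List (Fin n) → List (Fin n) → List (Fin n)
  | k + 1, v :: l, m => if v ∈ m then dfs nb k l m else dfs nb k (nb v ++ l) (v :: m)
  | _, _, m => m

lemma IsCubicList.reflTransGen_of_mem_dfs (h : IsCubicList nb) {s t u : Fin n} (k : ℕ)
    (l m : List (Fin n)) (hs : s ∈ m) (ht : t ∈ m)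
    (hl : ∀ v ∈ l, v ≠ s → v ≠ t → Relation.ReflTransGen (AdjAvoiding (ofNbrs nb) s t) u v)
    (hm : ∀ v ∈ m, v ≠ s → v ≠ t → Relation.ReflTransGen (AdjAvoiding (ofNbrs nb) s t) u v) :
    ∀ v ∈ dfs nb k l m, v ≠ s → v ≠ t →
      Relation.ReflTransGen (AdjAvoiding (ofNbrs nb) s t) u v := by
  induction k generalizing l m with
  | zero => simpa [dfs] using hm
  | succ k ih =>
    cases l with
    | nil => simpa [dfs] using hm
    | cons p l =>
      rw [dfs]
      split_ifs with hp
      · exact ih l m hs ht (fun v hv => hl v (List.mem_cons_of_mem _ hv)) hm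
      · have h1 : p ≠ s := fun e => hp (e ▸ hs)
        have h2 : p ≠ t := fun e => hp (e ▸ ht)
        have h3 := hl p List.mem_cons_self h1 h2
        refine ih _ _ (List.mem_cons_of_mem _ hs) (List.mem_cons_of_mem _ ht) ?_ ?_
        · intro v hv h4 h5
          rcases List.mem_append.1 hv with hv | hv
          · exact h3.tail ⟨h.adj_iff.2 hv, h1, h2, h4, h5⟩
          · exact hl v (List.mem_cons_of_mem _ hv) h4 h5
        · intro v hv h4 h5
          rcases List.mem_cons.1 hv with rfl | hv
          · exact h3
          · exact hm v hv h4 h5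

/-- Depth-first search finds all vertices after the deletion of any two. -/
def IsConnList (nb : Fin n → List (Fin n)) : Prop :=
  -- Each visited vertex of a cubic list pushes three neighbours, so `3 * n` steps empty the stack.
  -- Soundness of the search does not depend on this bound.
  ∀ s t, s ≤ t → ∃ u, u ≠ s ∧ u ≠ t ∧ ∀ v, v ∈ dfs nb (3 * n) [u] [s, t]

instance (nb : Fin n → List (Fin n)) : Decidable (IsConnList nb) := by
  unfold IsConnList; infer_instance

lemma IsCubicList.conn3 (h : IsCubicList nb) (hc : IsConnList nb) : Conn3 (ofNbrs nb) := by
  intro s t u v h1 h2 h3 h4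
  wlog hst : s ≤ t generalizing s t
  · have := this t s h2 h1 h4 h3 (le_of_not_ge hst)
    refine Relation.ReflTransGen.mono (fun p q h => ?_) _ _ this
    exact ⟨h.1, h.2.2.1, h.2.1, h.2.2.2.2, h.2.2.2.1⟩
  obtain ⟨r, hr, hr', H⟩ := hc s t hst
  have key := fun v => h.reflTransGen_of_mem_dfs (s := s) (t := t) (u := r) (3 * n) [r] [s, t]
    (by simp) (by simp)
    (fun v hv _ _ => by obtain rfl := List.mem_singleton.1 hv; exact .refl)
    (fun v hv h1 h2 => by simp [h1, h2] at hv) v (H v)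
  have : Std.Symm (AdjAvoiding (ofNbrs nb) s t) := ⟨fun _ _ h => h.symm⟩
  exact (Relation.ReflTransGen.stdSymm.symm _ _ (key u h1 h2)).trans (key v h3 h4)

/-- All extensions of a partial matching by at most `k` edges, as lists of pairs. -/
def search (nb : Fin n → List (Fin n)) : ℕ → List (Fin n × Fin n) → List (List (Fin n × Fin n))
  | 0, l => [l]
  | k + 1, l => match (List.finRange n).find? fun v => (l.lookup v).isNone with
    | none => [l]
    | some v => (nb v).flatMap fun w =>
        if ∃ p ∈ l, p.2 = w then [] else search nb k ((v, w) :: (w, v) :: l)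

/-- The map described by a list of pairs. -/
def mate (l : List (Fin n × Fin n)) (v : Fin n) : Fin n := (l.lookup v).getD v

/-- The perfect matchings of a graph given by lists of neighbours. -/
def matchings (nb : Fin n → List (Fin n)) : List (List (Fin n × Fin n)) := search nb n []

/-- The search found perfect matchings only. -/
def IsMatchingList (nb : Fin n → List (Fin n)) : Prop :=
  ∀ l ∈ matchings nb, ∀ v, (l.lookup v).isSome ∧ mate l v ∈ nb v ∧ mate l (mate l v) = v

instance (nb : Fin n → List (Fin n)) : Decidable (IsMatchingList nb) := by
  unfold IsMatchingList; infer_instance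

lemma mem_of_lookup {l : List (Fin n × Fin n)} {v w : Fin n} (h : l.lookup v = some w) :
    (v, w) ∈ l := by
  induction l with
  | nil => simp at h
  | cons p l ih =>
    obtain ⟨p1, p2⟩ := p
    rw [List.lookup_cons] at h
    split at h
    · simp_all
    · exact List.mem_cons_of_mem _ (ih h)

lemma lookup_ne_none {l : List (Fin n × Fin n)} {v w : Fin n} (h : (v, w) ∈ l) :
    l.lookup v ≠ none := by
  induction l with
  | nil => simp at h
  | cons p l ih =>
    obtain ⟨p1, p2⟩ := p
    rw [List.lookup_cons]
    split
    · simp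
    · rename_i hne
      rcases List.mem_cons.1 h with h | h
      · simp_all
      · exact ih h

/-- Completeness of the search: at the first unmatched vertex `v`, the branch `w = f v` follows `f`.
That the search yields only perfect matchings is left to the evaluated check `IsMatchingList`. -/
lemma IsCubicList.exists_mem_search (h : IsCubicList nb) {f : Fin n → Fin n}
    (hf : IsPM (ofNbrs nb) f) (k : ℕ) (l : List (Fin n × Fin n)) (hl : ∀ p ∈ l, f p.1 = p.2) :
    ∃ l' ∈ search nb k l, ∀ p ∈ l', f p.1 = p.2 := by
  induction k generalizing l with
  | zero => exact ⟨l, by simp [search], hl⟩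
  | succ k ih =>
    rw [search]
    split
    · exact ⟨l, by simp, hl⟩
    · rename_i v hv
      have hv := List.find?_some hv
      obtain ⟨l', h1, h2⟩ := ih ((v, f v) :: (f v, v) :: l) (by
        simp only [List.mem_cons, forall_eq_or_imp]
        exact ⟨trivial, hf.invol v, hl⟩)
      refine ⟨l', List.mem_flatMap.2 ⟨f v, h.adj_iff.1 (hf.adj v), ?_⟩, h2⟩
      rw [if_neg]
      · exact h1
      -- If `f v` were already a mate in `l`, its partner would be `v` by injectivity of `f`, but
      -- `v` has no entry in `l`.
      · rintro ⟨⟨p, q⟩, hp, rfl⟩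
        have h3 := hl _ hp
        have h4 : p = v := by rw [← hf.invol p, ← hf.invol v]; exact congrArg f h3
        subst h4
        exact lookup_ne_none hp (by simpa using hv)

lemma IsCubicList.isPM_iff (h : IsCubicList nb) (hm : IsMatchingList nb) {f : Fin n → Fin n} :
    IsPM (ofNbrs nb) f ↔ ∃ l ∈ matchings nb, f = mate l := by
  constructor
  · intro hf
    obtain ⟨l, hl, H⟩ := h.exists_mem_search hf n [] (by simp)
    refine ⟨l, hl, funext fun v => ?_⟩
    obtain ⟨w, hw⟩ := Option.isSome_iff_exists.1 (hm l hl v).1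
    rw [mate, hw]
    exact H _ (mem_of_lookup hw)
  · rintro ⟨l, hl, rfl⟩ v
    exact ⟨h.adj_iff.2 (hm l hl v).2.1, (hm l hl v).2.2⟩

lemma IsCubicList.inOne (h : IsCubicList nb) (hm : IsMatchingList nb) {p q : Fin n}
    (H : ∃ l ∈ matchings nb, mate l p = q ∧ ∀ l' ∈ matchings nb, mate l' p = q →
      ∀ v, mate l' v = mate l v) : InOne (ofNbrs nb) p q := by
  obtain ⟨l, hl, e, hu⟩ := H
  refine ⟨mate l, (h.isPM_iff hm).2 ⟨l, hl, rfl⟩, e, fun g hg e' => ?_⟩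
  obtain ⟨l', hl', rfl⟩ := (h.isPM_iff hm).1 hg
  exact funext (hu l' hl' e')

/-- All edges but those in the list `E` lie in two perfect matchings. -/
def AreTwoExcept (nb : Fin n → List (Fin n)) (E : List (Fin n × Fin n)) : Prop :=
  ∀ p, ∀ q ∈ nb p, (p, q) ∈ E ∨ (q, p) ∈ E ∨ ∃ l ∈ matchings nb, mate l p = q ∧
    ∃ l' ∈ matchings nb, mate l' p = q ∧ ∃ v, mate l v ≠ mate l' v

instance (nb : Fin n → List (Fin n)) (E : List (Fin n × Fin n)) :
    Decidable (AreTwoExcept nb E) := by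
  unfold AreTwoExcept; infer_instance

lemma IsCubicList.inTwo (h : IsCubicList nb) (hm : IsMatchingList nb) {E : List (Fin n × Fin n)}
    (H : AreTwoExcept nb E) {p q : Fin n} (hpq : (ofNbrs nb).Adj p q) (h1 : (p, q) ∉ E)
    (h2 : (q, p) ∉ E) : InTwo (ofNbrs nb) p q := by
  obtain ⟨l, hl, e, l', hl', e', v, hv⟩ :=
    ((H p q (h.adj_iff.1 hpq)).resolve_left h1).resolve_left h2
  exact ⟨mate l, mate l', fun e => hv (congrFun e v), (h.isPM_iff hm).2 ⟨l, hl, rfl⟩,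
    (h.isPM_iff hm).2 ⟨l', hl', rfl⟩, e, e'⟩

end Neighbours

/-! ### From seeds and neighbour lists to the classes `𝒰_n` -/

section Final

lemma IsSeed.inUWith {V : Type*} [Fintype V] {G : SimpleGraph V} [DecidableRel G.Adj] {x a b : V}
    {F : Set (Sym2 V)} (h : IsSeed G x a b F) (hV : 5 ≤ Fintype.card V) :
    InUWith G (F.ncard + 1) := by
  have hF : s(x, a) ∉ F := by
    intro hF
    obtain ⟨f, hf, e, e', -⟩ := h.inOne_of_mem _ _ hF
    have := hf.invol x
    rw [e, e'] at this
    exact h.adj_xb.ne this.symm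
  rw [← Set.ncard_insert_of_notMem hF (Set.toFinite _)]
  refine inUWith_of hV h.cubic h.conn3 (Set.insert_nonempty _ _) ?_ ?_
  · rintro p q (e | hpq)
    · rcases Sym2.eq_iff.1 e with ⟨rfl, rfl⟩ | ⟨rfl, rfl⟩
      · exact h.inOne
      · exact h.inOne.symm
    · obtain ⟨f, hf, e, -, hu⟩ := h.inOne_of_mem p q hpq
      exact ⟨f, hf, e, hu⟩
  · intro p q hpq hE
    rw [Set.mem_insert_iff, not_or] at hE
    exact h.inTwo p q hpq hE.1 hE.2

/-- The number of lonely edges is constant because `F` is transported along the injection `inl`,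
while the special edge is replaced by a single new one. -/
lemma IsSeed.iterate {V : Type} [Fintype V] {G : SimpleGraph V} {x a b : V}
    {F : Set (Sym2 V)} (h : IsSeed G x a b F) (hV : 5 ≤ Fintype.card V) (j : ℕ) :
    ∃ (W : Type) (_ : Fintype W) (H : SimpleGraph W) (y c d : W) (E : Set (Sym2 W)),
      IsSeed H y c d E ∧ 5 ≤ Fintype.card W ∧ E.ncard = F.ncard ∧
      (H.cliqueSet 3).ncard = (G.cliqueSet 3).ncard + j := by
  induction j with
  | zero => exact ⟨V, _, G, x, a, b, F, h, hV, rfl, rfl⟩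
  | succ j ih =>
    obtain ⟨W, _, H, y, c, d, E, h1, h2, h3, h4⟩ := ih
    refine ⟨W ⊕ Fin 4, inferInstance, _, _, _, _, _, h1.expand, ?_, ?_, ?_⟩
    · rw [Fintype.card_sum]; omega
    · rw [Set.ncard_image_of_injective _ (Sym2.map.injective Sum.inl_injective), h3]
    · rw [h1.ncard_cliqueSet_expand, h4, add_assoc]

lemma IsSeed.exists_inUWith {V : Type} [Fintype V] {G : SimpleGraph V} {x a b : V}
    {F : Set (Sym2 V)} (h : IsSeed G x a b F) (hV : 5 ≤ Fintype.card V) {m k : ℕ}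
    (hm : F.ncard + 1 = m) (hk : (G.cliqueSet 3).ncard ≤ k) :
    ∃ (V : Type) (_ : Fintype V) (_ : DecidableEq V) (G : SimpleGraph V)
      (_ : DecidableRel G.Adj), InUWith G m ∧ (G.cliqueFinset 3).card = k := by
  classical
  obtain ⟨j, rfl⟩ := Nat.exists_eq_add_of_le hk
  obtain ⟨W, i, H, y, c, d, E, h1, h2, h3, h4⟩ := h.iterate hV j
  refine ⟨W, i, inferInstance, H, inferInstance, ?_, ?_⟩
  · rw [← hm, ← h3]
    exact h1.inUWith h2
  · rw [← h4, ← SimpleGraph.coe_cliqueFinset, Set.ncard_coe_finset]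

variable {n : ℕ} {nb : Fin n → List (Fin n)}

/-- The list `L` contains every triangle exactly once. -/
def IsTriangleList (nb : Fin n → List (Fin n)) (L : List (Finset (Fin n))) : Prop :=
  L.Nodup ∧ (∀ T ∈ L, ∃ p, ∃ q ∈ nb p, ∃ r ∈ nb q, r ∈ nb p ∧ T = {p, q, r}) ∧
    ∀ p, ∀ q ∈ nb p, ∀ r ∈ nb q, r ∈ nb p → {p, q, r} ∈ L

instance (nb : Fin n → List (Fin n)) (L : List (Finset (Fin n))) :
    Decidable (IsTriangleList nb L) := by
  have : Decidable (∀ T ∈ L, ∃ p, ∃ q ∈ nb p, ∃ r ∈ nb q, r ∈ nb p ∧ T = {p, q, r}) :=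
    List.decidableBAll _ _
  unfold IsTriangleList; infer_instance

lemma IsCubicList.card_cliqueFinset (h : IsCubicList nb) {L : List (Finset (Fin n))}
    (hL : IsTriangleList nb L) : ((ofNbrs nb).cliqueFinset 3).card = L.length := by
  rw [← List.toFinset_card_of_nodup hL.1]
  congr 1
  ext T
  rw [SimpleGraph.mem_cliqueFinset_iff, List.mem_toFinset, SimpleGraph.is3Clique_iff]
  simp only [h.adj_iff]
  constructor
  · rintro ⟨p, q, r, h1, h2, h3, rfl⟩
    exact hL.2.2 p q h1 r h3 h2
  · intro hT
    obtain ⟨p, q, h1, r, h2, h3, rfl⟩ := hL.2.1 T hT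
    exact ⟨p, q, r, h1, h3, h2, rfl⟩

lemma IsCubicList.ncard_cliqueSet (h : IsCubicList nb) {L : List (Finset (Fin n))}
    (hL : IsTriangleList nb L) : ((ofNbrs nb).cliqueSet 3).ncard = L.length := by
  rw [← h.card_cliqueFinset hL, ← SimpleGraph.coe_cliqueFinset, Set.ncard_coe_finset]

/-- The pairs in the list `E` lie in one perfect matching each. -/
def AreOne (nb : Fin n → List (Fin n)) (E : List (Fin n × Fin n)) : Prop :=
  ∀ e ∈ E, ∃ l ∈ matchings nb, mate l e.1 = e.2 ∧
    ∀ l' ∈ matchings nb, mate l' e.1 = e.2 → ∀ v, mate l' v = mate l v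

instance (nb : Fin n → List (Fin n)) (E : List (Fin n × Fin n)) : Decidable (AreOne nb E) :=
  List.decidableBAll _ _

/-- The vertices `x, a, b` form a triangle which has no edge in common with another triangle. -/
def IsIsolatedTriangle (nb : Fin n → List (Fin n)) (x a b : Fin n) : Prop :=
  (a ∈ nb x ∧ b ∈ nb x ∧ b ∈ nb a) ∧ (∀ w, w ∈ nb x → w ∈ nb a → w = b) ∧
    (∀ w, w ∈ nb x → w ∈ nb b → w = a) ∧ (∀ w, w ∈ nb a → w ∈ nb b → w = x)

instance (nb : Fin n → List (Fin n)) (x a b : Fin n) : Decidable (IsIsolatedTriangle nb x a b) := by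
  unfold IsIsolatedTriangle; infer_instance

/-- The conditions on the triangle of a seed whose lonely edges are `xa` and the members of
the list `E`. -/
def IsSeedList (nb : Fin n → List (Fin n)) (x a b : Fin n) (E : List (Fin n × Fin n)) : Prop :=
  IsIsolatedTriangle nb x a b ∧
  AreOne nb ((x, a) :: E) ∧
  (∀ e ∈ E, ∀ l ∈ matchings nb, mate l e.1 = e.2 → mate l a = b) ∧
  ((a, b) ∉ E ∧ (b, a) ∉ E) ∧
  ∃ l ∈ matchings nb, mate l x ≠ a ∧ mate l x ≠ b ∧ mate l a ≠ b

instance (nb : Fin n → List (Fin n)) (x a b : Fin n) (E : List (Fin n × Fin n)) :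
    Decidable (IsSeedList nb x a b E) := by
  have : Decidable (∀ e ∈ E, ∀ l ∈ matchings nb, mate l e.1 = e.2 → mate l a = b) :=
    List.decidableBAll _ _
  unfold IsSeedList; infer_instance

lemma IsCubicList.isSeed (h : IsCubicList nb) (hc : IsConnList nb) (hm : IsMatchingList nb)
    {x a b : Fin n} {E : List (Fin n × Fin n)} (hs : IsSeedList nb x a b E)
    (ht : AreTwoExcept nb ((x, a) :: E)) :
    IsSeed (ofNbrs nb) x a b {e | ∃ p ∈ E, e = s(p.1, p.2)} := by
  obtain ⟨⟨⟨h1, h2, h3⟩, h4, h5, h6⟩, h7, h8, ⟨h9, h10⟩, l₀, hl₀, h11⟩ := hs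
  refine
    { cubic := h.cubic
      conn3 := h.conn3 hc
      adj_xa := h.adj_iff.2 h1
      adj_xb := h.adj_iff.2 h2
      adj_ab := h.adj_iff.2 h3
      common_xa := by simpa only [h.adj_iff] using h4
      common_xb := by simpa only [h.adj_iff] using h5
      common_ab := by simpa only [h.adj_iff] using h6
      inOne := h.inOne hm (h7 (x, a) List.mem_cons_self)
      inOne_of_mem := ?_
      notMem := ?_
      inTwo := ?_
      exists_outer := ⟨mate l₀, (h.isPM_iff hm).2 ⟨l₀, hl₀, rfl⟩, h11⟩ }
  · rintro p q ⟨⟨p', q'⟩, he, hpq⟩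
    obtain ⟨l, hl, e, hu⟩ := h7 _ (List.mem_cons_of_mem _ he)
    have hab := h8 _ he l hl e
    have hl' := (h.isPM_iff hm).2 ⟨l, hl, rfl⟩
    have hu' : ∀ g, IsPM (ofNbrs nb) g → g p' = q' → g = mate l := fun g hg e' => by
      obtain ⟨l', hl', rfl⟩ := (h.isPM_iff hm).1 hg
      exact funext (hu l' hl' e')
    simp only at e
    rcases Sym2.eq_iff.1 hpq with ⟨rfl, rfl⟩ | ⟨rfl, rfl⟩
    · exact ⟨mate l, hl', e, hab, hu'⟩
    · refine ⟨mate l, hl', e ▸ hl'.invol q, hab, fun g hg e' => hu' g hg ?_⟩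
      exact e' ▸ hg.invol p
  · rintro ⟨⟨p, q⟩, he, hpq⟩
    rcases Sym2.eq_iff.1 hpq with ⟨rfl, rfl⟩ | ⟨rfl, rfl⟩
    · exact h9 he
    · exact h10 he
  · intro p q hpq hne hE
    refine h.inTwo hm ht hpq ?_ ?_ <;> rw [List.mem_cons, not_or]
    · exact ⟨fun e => hne (by simp_all), fun he => hE ⟨_, he, rfl⟩⟩
    · refine ⟨fun e => hne ?_, fun he => hE ⟨_, he, Sym2.eq_swap⟩⟩
      obtain ⟨rfl, rfl⟩ := Prod.ext_iff.1 e
      exact Sym2.eq_swap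

lemma IsCubicList.inUWith (h : IsCubicList nb) (hc : IsConnList nb) (hm : IsMatchingList nb)
    (hn : 5 ≤ n) {E : List (Fin n × Fin n)} (hE : E ≠ [])
    (hs : AreOne nb E) (ht : AreTwoExcept nb E) :
    InUWith (ofNbrs nb) {e : Sym2 (Fin n) | ∃ p ∈ E, e = s(p.1, p.2)}.ncard := by
  refine inUWith_of (by simpa using hn) h.cubic (h.conn3 hc) ?_ ?_ ?_
  · obtain ⟨e, he⟩ := List.exists_mem_of_ne_nil _ hE
    exact ⟨_, e, he, rfl⟩
  · rintro p q ⟨⟨p', q'⟩, he, hpq⟩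
    rcases Sym2.eq_iff.1 hpq with ⟨rfl, rfl⟩ | ⟨rfl, rfl⟩
    · exact h.inOne hm (hs _ he)
    · exact (h.inOne hm (hs _ he)).symm
  · intro p q hpq hE
    exact h.inTwo hm ht hpq (fun he => hE ⟨_, he, rfl⟩) (fun he => hE ⟨_, he, Sym2.eq_swap⟩)

end Final

/-! ### The four explicit graphs -/

section Examples

/-- Neighbours in a graph with two lonely edges and two triangles. -/
def nbrsTwoTwo : Fin 14 → List (Fin 14) :=
  ![[1, 2, 4], [0, 2, 13], [0, 1, 3], [2, 4, 6], [0, 3, 5], [4, 6, 10], [3, 5, 7], [6, 12, 13],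
    [11, 12, 13], [10, 11, 12], [5, 9, 11], [8, 9, 10], [7, 8, 9], [1, 7, 8]]

/-- Neighbours in a graph with two lonely edges and three triangles. -/
def nbrsTwoThree : Fin 12 → List (Fin 12) :=
  ![[1, 2, 4], [0, 2, 11], [0, 1, 3], [2, 4, 7], [0, 3, 5], [4, 8, 10], [7, 8, 9], [3, 6, 8],
    [5, 6, 7], [6, 10, 11], [5, 9, 11], [1, 9, 10]]

/-- Neighbours in a graph with one lonely edge and two triangles. -/
def nbrsOneTwo : Fin 16 → List (Fin 16) :=
  ![[1, 3, 6], [0, 4, 15], [3, 4, 5], [0, 2, 4], [1, 2, 3], [2, 6, 8], [0, 5, 7], [6, 8, 12],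
    [5, 7, 9], [8, 14, 15], [13, 14, 15], [12, 13, 14], [7, 11, 13], [10, 11, 12], [9, 10, 11],
    [1, 9, 10]]

/-- Neighbours in a graph with one lonely edge and three triangles. -/
def nbrsOneThree : Fin 14 → List (Fin 14) :=
  ![[1, 2, 4], [0, 2, 13], [0, 1, 3], [2, 4, 8], [0, 3, 5], [4, 10, 12], [9, 10, 11], [8, 9, 10],
    [3, 7, 9], [6, 7, 8], [5, 6, 7], [6, 12, 13], [5, 11, 13], [1, 11, 12]]

lemma inUWith_nbrsTwoTwo : InUWith (ofNbrs nbrsTwoTwo) 2 := by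
  have h := IsCubicList.inUWith (nb := nbrsTwoTwo) (E := [(0, 1), (10, 11)]) (by decide +kernel)
    (by decide +kernel) (by decide +kernel) (by norm_num) (by simp) (by decide +kernel)
    (by decide +kernel)
  have e : {e : Sym2 (Fin 14) | ∃ p ∈ [((0 : Fin 14), (1 : Fin 14)), (10, 11)],
      e = s(p.1, p.2)} = {s(0, 1), s(10, 11)} := by
    ext e; simp
  rwa [e, Set.ncard_pair (by decide)] at h

lemma inUWith_nbrsOneTwo : InUWith (ofNbrs nbrsOneTwo) 1 := by
  have h := IsCubicList.inUWith (nb := nbrsOneTwo) (E := [(0, 1)]) (by decide +kernel)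
    (by decide +kernel) (by decide +kernel) (by norm_num) (by simp) (by decide +kernel)
    (by decide +kernel)
  have e : {e : Sym2 (Fin 16) | ∃ p ∈ [((0 : Fin 16), (1 : Fin 16))], e = s(p.1, p.2)} =
      {s(0, 1)} := by
    ext e; simp
  rwa [e, Set.ncard_singleton] at h

lemma card_cliqueFinset_nbrsTwoTwo : ((ofNbrs nbrsTwoTwo).cliqueFinset 3).card = 2 :=
  IsCubicList.card_cliqueFinset (L := [{0, 1, 2}, {9, 10, 11}]) (by decide +kernel)
    (by decide +kernel)

lemma card_cliqueFinset_nbrsOneTwo : ((ofNbrs nbrsOneTwo).cliqueFinset 3).card = 2 :=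
  IsCubicList.card_cliqueFinset (L := [{2, 3, 4}, {11, 12, 13}]) (by decide +kernel)
    (by decide +kernel)

lemma ncard_cliqueSet_nbrsTwoThree : ((ofNbrs nbrsTwoThree).cliqueSet 3).ncard = 3 :=
  IsCubicList.ncard_cliqueSet (L := [{0, 1, 2}, {6, 7, 8}, {9, 10, 11}]) (by decide +kernel)
    (by decide +kernel)

lemma ncard_cliqueSet_nbrsOneThree : ((ofNbrs nbrsOneThree).cliqueSet 3).ncard = 3 :=
  IsCubicList.ncard_cliqueSet (L := [{0, 1, 2}, {7, 8, 9}, {11, 12, 13}]) (by decide +kernel)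
    (by decide +kernel)

lemma isSeed_nbrsTwoThree : IsSeed (ofNbrs nbrsTwoThree) 0 1 2 {s(9, 11)} := by
  have h := IsCubicList.isSeed (nb := nbrsTwoThree) (x := 0) (a := 1) (b := 2) (E := [(9, 11)])
    (by decide +kernel) (by decide +kernel) (by decide +kernel) (by decide +kernel)
    (by decide +kernel)
  have e : {e : Sym2 (Fin 12) | ∃ p ∈ [((9 : Fin 12), (11 : Fin 12))], e = s(p.1, p.2)} =
      {s(9, 11)} := by
    ext e; simp
  rwa [e] at h

lemma isSeed_nbrsOneThree : IsSeed (ofNbrs nbrsOneThree) 0 1 2 ∅ := by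
  have h := IsCubicList.isSeed (nb := nbrsOneThree) (x := 0) (a := 1) (b := 2) (E := [])
    (by decide +kernel) (by decide +kernel) (by decide +kernel) (by decide +kernel)
    (by decide +kernel)
  have e : {e : Sym2 (Fin 14) | ∃ p ∈ ([] : List (Fin 14 × Fin 14)), e = s(p.1, p.2)} = ∅ := by
    ext e; simp
  rwa [e] at h

end Examples

end LonelyEdges

theorem mainTheorem6 (k : ℕ) (hk : 2 ≤ k) :
    (∃ (V : Type) (_ : Fintype V) (_ : DecidableEq V) (G : SimpleGraph V)
        (_ : DecidableRel G.Adj),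
      LonelyEdges.InUWith G 2 ∧ (G.cliqueFinset 3).card = k) ∧
    (∃ (V : Type) (_ : Fintype V) (_ : DecidableEq V) (G : SimpleGraph V)
        (_ : DecidableRel G.Adj),
      LonelyEdges.InUWith G 1 ∧ (G.cliqueFinset 3).card = k) := by
  obtain rfl | hk : k = 2 ∨ 3 ≤ k := by omega
  -- The case `k = 2` stands alone: the lonely edge of the 16-vertex graph lies in no triangle, so
  -- that graph is not a seed.
  · exact ⟨⟨Fin 14, _, _, _, _, LonelyEdges.inUWith_nbrsTwoTwo,
        LonelyEdges.card_cliqueFinset_nbrsTwoTwo⟩,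
      Fin 16, _, _, _, _, LonelyEdges.inUWith_nbrsOneTwo,
      LonelyEdges.card_cliqueFinset_nbrsOneTwo⟩
  · exact ⟨LonelyEdges.isSeed_nbrsTwoThree.exists_inUWith (by simp) (by simp)
        (LonelyEdges.ncard_cliqueSet_nbrsTwoThree.trans_le hk),
      LonelyEdges.isSeed_nbrsOneThree.exists_inUWith (by simp) (by simp)
        (LonelyEdges.ncard_cliqueSet_nbrsOneThree.trans_le hk)⟩
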